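/- **Setting.** Let $J,T\in\mathbb N$ and $0<a_t\le b_t$ for $t=1,\dots,T$. Let $\Omega$ be a non-empty closed subset of $\prod_{t=1}^T\big([a_t,b_t]\times\mathbb R_+^J\big)$ with its Euclidean topology and Borel $\sigma$-algebra. Put $S^0_0=1$, let $S^j_0\in\mathbb R_+$ ($j=1,\dots,J$) be given numbers, and put $S^j_t(\omega)=\omega^j_t$ for $t=1,\dots,T$, $j=0,\dots,J$. Let $\mathcal F_t=\sigma(S^j_s: j=0,\dots,J,\ s\le t)$, $\tilde S^j_t=S^j_t/S^0_t$ and $\Delta\tilde S^j_t=\tilde S^j_t-\tilde S^j_{t-1}$. Fix $p\ge 1$ and let $Z=1+\sum_{j=1}^J\sum_{t=1}^T(\tilde S^j_t)^p$. Let $B$ be the set of Borel functions $X:\Omega\to\mathbb R$, $B^+=\{X\in B: X\ge 0\}$, $B_Z=\{X\in B: X/Z\text{ bounded}\}$, and let $U_Z$ and $C_Z$ be the sets of upper semicontinuous and of continuous elements of $B_Z$, respectively. Let $\mathcal P_Z$ be the set of Borel probability measures $\mathbb P$ on $\Omega$ with $\mathbb E^{\mathbb P}Z<\infty$. For $X\in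 B$ put $\mathbb E^{\mathbb P}X:=\mathbb E^{\mathbb P}X^+-\mathbb E^{\mathbb P}X^-$ if $\mathbb E^{\mathbb P}X^-<\infty$ and $\mathbb E^{\mathbb P}X:=-\infty$ otherwise. Let $I$ be any index set, $H_i\in C_Z$ for $i\in I$, let $\Theta$ be a convex set, containing $0$, of vectors in $\mathbb R^I$ with at most finitely many non-zero components, and let $h:\Theta\to C_Z$ be convex (for the pointwise order) with $h(0)=0$. Let $G$ be the set of all $$\sum_{t=1}^T\sum_{j=1}^J\vartheta^j_t\,\Delta\tilde S^j_t+\sum_{i\in I}\theta_iH_i-h(\theta),$$ where $\theta\in\Theta$ and each $\vartheta^j_t:\Omega\to[0,\infty)$ is $\mathcal F_{t-1}$-measurable. Define $$\phi(X)=\inf\{m\in\mathbb R: m-X\in B^+-G\}\quad(\inf\emptyset=+\infty),\qquad \phi^*_G(\mathbb P)=\sup_{X\in G}\mathbb E^{\mathbb P}X\quad(\mathbb P\in\mathcal P_Z),$$ and $\mathcal M=\{\mathbb P\in\mathcal P_Z:\phi^*_G(\mathbb P)=0\}$. **Proposition 3.2.** For every $\mathbb P\in\mathcal P_Z$, $$\phi^*_G(\mathbb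 P)=\begin{cases}\sup_{\theta\in\Theta}\mathbb E^{\mathbb P}\big(\sum_{i\in I}\theta_iH_i-h(\theta)\big)&\text{if }\tilde S^1,\dots,\tilde S^J\text{ are }(\mathcal F_t)\text{-supermartingales under }\mathbb P,\\+\infty&\text{otherwise.}\end{cases}$$ If, moreover, for all integers $n\ge1$, all $j=1,\dots,J$ and all $t=1,\dots,T$ there exist $X\in G$ and $K\in\mathbb R_+$ such that $X\ge n\big((\tilde S^j_t)^p-K\big)^+-1/n$ on $\Omega$, then the following four conditions are equivalent: (i) there exist no $X\in G$ and $\varepsilon>0$ such that $X\ge\varepsilon$ on $\Omega$; (ii) there exists no $X\in G$ such that $X(\omega)>0$ for all $\omega\in\Omega$; (iii) $\mathcal M\ne\emptyset$; (iv) $\phi$ is real-valued on $B_Z$, $\phi(0)=0$, and for every $X\in U_Z$ $$\phi(X)=\max_{\mathbb P\in\mathcal P_Z}\big(\mathbb E^{\mathbb P}X-\phi^*_G(\mathbb P)\big),$$ the maximum being attained. -/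

import Mathlib

open MeasureTheory
open scoped Pointwise

noncomputable section

namespace ShortSelling

/-! A scenario is a path `ω` with `ω k j` the nominal price of asset `j` at time `k + 1`,
`k = 0, …, T - 1`. Asset `0` is the numeraire. `Ω` is the set of possible scenarios; it carries the
topology and the Borel sigma-algebra inherited from `ℝ ^ ((J + 1) T)`. -/

section Model

variable {J T : ℕ} {Ω : Set (Fin T → Fin (J + 1) → ℝ)}

/-- Nominal price of asset `j` at time `t = 0, …, T`: at time `0` it is the constant `1` for the
numeraire and `s₀ j` for the other assets, and afterwards it is read off the scenario. -/
def price (s₀ : Fin J → ℝ) (t : Fin (T + 1)) (j : Fin (J + 1)) (ω : Ω) : ℝ :=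
  Fin.cases (motive := fun _ => ℝ)
    (Fin.cases (motive := fun _ => ℝ) 1 s₀ j) (fun k => (ω : Fin T → Fin (J + 1) → ℝ) k j) t

/-- Price at time `t` of the `j`-th risky asset, in units of the numeraire. -/
def discPrice (s₀ : Fin J → ℝ) (t : Fin (T + 1)) (j : Fin J) (ω : Ω) : ℝ :=
  price s₀ t j.succ ω / price s₀ t 0 ω

theorem stronglyMeasurable_price (s₀ : Fin J → ℝ) (t : Fin (T + 1)) :
    StronglyMeasurable (fun (ω : Ω) (j : Fin (J + 1)) => price s₀ t j ω) := by
  apply Measurable.stronglyMeasurable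
  refine measurable_pi_lambda _ fun j => ?_
  refine Fin.cases ?_ (fun k => ?_) t
  · exact measurable_const
  · exact (measurable_pi_apply j).comp ((measurable_pi_apply k).comp measurable_subtype_coe)

/-- The filtration generated by the nominal prices of all assets. -/
def priceFiltration (Ω : Set (Fin T → Fin (J + 1) → ℝ)) (s₀ : Fin J → ℝ) :
    Filtration (Fin (T + 1)) (Subtype.instMeasurableSpace : MeasurableSpace Ω) :=
  Filtration.natural (fun t (ω : Ω) (j : Fin (J + 1)) => price s₀ t j ω)
    (stronglyMeasurable_price s₀)

/-- The growth function `Z`. -/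
def growth (s₀ : Fin J → ℝ) (p : ℝ) (ω : Ω) : ℝ :=
  1 + ∑ k : Fin T, ∑ j : Fin J, discPrice s₀ k.succ j ω ^ p

/-- The gain of dynamic trading. Here `ϑ k j` is the number of shares of the `j`-th risky asset held
from time `k` to time `k + 1`, `k = 0, …, T - 1`. -/
def dynGain (s₀ : Fin J → ℝ) (ϑ : Fin T → Fin J → Ω → ℝ) (ω : Ω) : ℝ :=
  ∑ k : Fin T, ∑ j : Fin J,
    ϑ k j ω * (discPrice s₀ k.succ j ω - discPrice s₀ k.castSucc j ω)

/-- Non-negative predictable strategies: the holdings from time `k` to time `k + 1` are known at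
time `k`. -/
def IsLongStrategy (s₀ : Fin J → ℝ) (ϑ : Fin T → Fin J → Ω → ℝ) : Prop :=
  ∀ k j, Measurable[priceFiltration Ω s₀ k.castSucc] (ϑ k j) ∧ ∀ ω, 0 ≤ ϑ k j ω

/-- The outcome of a static position `θ` (only finitely many non-zero components) in the
derivatives `H i`, net of the cost `h θ`. -/
def staticGain {I : Type*} (H : I → Ω → ℝ) (h : (I →₀ ℝ) → Ω → ℝ) (θ : I →₀ ℝ) (ω : Ω) : ℝ :=
  (θ.sum fun i c => c * H i ω) - h θ ω

/-- The set `G` of discounted trading gains. -/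
def gains {I : Type*} (s₀ : Fin J → ℝ) (H : I → Ω → ℝ) (Θ : Set (I →₀ ℝ))
    (h : (I →₀ ℝ) → Ω → ℝ) : Set (Ω → ℝ) :=
  {X | ∃ ϑ : Fin T → Fin J → Ω → ℝ, IsLongStrategy s₀ ϑ ∧ ∃ θ ∈ Θ,
    X = fun ω => dynGain s₀ ϑ ω + staticGain H h θ ω}

/-- Every risky discounted price is a supermartingale under `P`. -/
def IsSupermartingaleMeasure (s₀ : Fin J → ℝ) (P : ProbabilityMeasure Ω) : Prop :=
  ∀ j : Fin J, Supermartingale (fun t (ω : Ω) => discPrice s₀ t j ω) (priceFiltration Ω s₀)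
    (P : Measure Ω)

/-- For each `n ≥ 1`, each risky asset and each time, `n` calls on the `p`-th power of the
discounted price can be superhedged at cost `1 / n`, if the strike is large enough. -/
def CallCondition (s₀ : Fin J → ℝ) (p : ℝ) (G : Set (Ω → ℝ)) : Prop :=
  ∀ n : ℕ, 1 ≤ n → ∀ (j : Fin J) (k : Fin T), ∃ X ∈ G, ∃ K : ℝ, 0 ≤ K ∧
    ∀ ω, (n : ℝ) * max (discPrice s₀ k.succ j ω ^ p - K) 0 - 1 / (n : ℝ) ≤ X ω

end Model

section Functionals

variable {E : Type*} [MeasurableSpace E]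

/-- The cone `B⁺` of non-negative measurable functions. -/
def posCone (E : Type*) [MeasurableSpace E] : Set (E → ℝ) :=
  {X | Measurable X ∧ ∀ ω, 0 ≤ X ω}

/-- `B_Z`: measurable functions `X` with `X / Z` bounded. -/
def boundedBy (Z : E → ℝ) : Set (E → ℝ) :=
  {X | Measurable X ∧ ∃ C : ℝ, ∀ ω, |X ω / Z ω| ≤ C}

/-- `U_Z`: upper semicontinuous elements of `B_Z`. -/
def uscBoundedBy [TopologicalSpace E] (Z : E → ℝ) : Set (E → ℝ) :=
  {X | X ∈ boundedBy Z ∧ UpperSemicontinuous X}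

/-- `C_Z`: continuous elements of `B_Z`. -/
def contBoundedBy [TopologicalSpace E] (Z : E → ℝ) : Set (E → ℝ) :=
  {X | X ∈ boundedBy Z ∧ Continuous X}

/-- `P_Z`: probability measures that integrate `Z`. -/
def probInt (Z : E → ℝ) : Set (ProbabilityMeasure E) :=
  {P | Integrable Z (P : Measure E)}

open Classical in
/-- The extended expectation `E X⁺ - E X⁻`, set to `-∞` if `E X⁻ = +∞`. -/
def expect (P : ProbabilityMeasure E) (X : E → ℝ) : EReal :=
  if ∫⁻ ω, ENNReal.ofReal (-X ω) ∂(P : Measure E) < ⊤ then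
    ((∫⁻ ω, ENNReal.ofReal (X ω) ∂(P : Measure E) : ENNReal) : EReal)
      - ((∫⁻ ω, ENNReal.ofReal (-X ω) ∂(P : Measure E) : ENNReal) : EReal)
  else ⊥

/-- The superhedging functional for an acceptance set `A` and a set of gains `G`;
the infimum of the empty set is `+∞`. -/
def superhedge (A G : Set (E → ℝ)) (X : E → ℝ) : EReal :=
  sInf ((fun m : ℝ => (m : EReal)) '' {m : ℝ | (fun ω => m - X ω) ∈ A - G})

/-- The penalty `φ*_G(P) = sup_{X ∈ G} E^P X`. -/
def penalty (G : Set (E → ℝ)) (P : ProbabilityMeasure E) : EReal :=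
  ⨆ X ∈ G, expect P X

/-- The set `M` of generalized martingale measures. -/
def genMartMeasures (Z : E → ℝ) (G : Set (E → ℝ)) : Set (ProbabilityMeasure E) :=
  {P | P ∈ probInt Z ∧ penalty G P = 0}

end Functionals

end ShortSelling

end

/-! The duality comes from a subgradient of the superhedging cost φ, which is a measure up to its
behaviour on discontinuous functions. If arbitrage is excluded and the tails of `Z` can be hedged
cheaply, φ is convex, monotone and real-valued on all functions dominated by `Z`, measurable or not.
Hahn–Banach gives a linear L with L(Y) ≤ φ(X + Y) − φ(X). Monotonicity makes L positive, cash
additivity gives L(1) = 1, and the tail hedges make L tight. Since the sublevel sets of `Z` are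
compact, the Riesz theorem yields a probability P with E Y = L(Y) for continuous dominated Y
(`exists_probabilityMeasure`). For upper semicontinuous X, approximation from above by continuous
functions gives L(X) ≤ E X. Taking Y = g − X with g a continuous dominated gain, for which φ(g) ≤ 0,
yields E g ≤ E X − φ(X) (`exists_dual`).

It remains to show that continuous dominated gains already determine the penalty. Bounded continuous
functions of past prices are admissible holdings and can be scaled up, so a finite bound on their
expected gains forces the one-step supermartingale inequality against such functions; regularity of
measures extends it to all past events (`isSupermartingaleMeasure`). Conversely, under a
supermartingale measure, holdings may be unbounded, but integrability of the negative part of the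
final gain propagates backwards in time, and then integrability and non-positive expectation
propagate forwards (`integral_dynGain_nonpos`). Only the static gains, which are continuous,
contribute to the penalty.

With weak duality this proves (i) ⇒ (iv), the only implication using the call condition. A maximizer
for X = 0 has zero penalty, a measure with zero penalty excludes strictly positive gains, and this
excludes gains bounded below by some ε > 0. -/

noncomputable section

namespace ShortSelling

open Set Filter Topology

/-! ### Linear minorants of convex functions -/

section Subgradient

variable {V : Type*} [AddCommGroup V] [Module ℝ V]

/-- The directional derivative at `0` of a function vanishing there. -/
def dirDeriv (q : V → ℝ) (v : V) : ℝ := ⨅ t : Ioi (0 : ℝ), q (t.1 • v) / t.1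

/-- The origin is a convex combination of t v and −v, so convexity gives the lower bound −q(−v)
uniformly in t. This keeps the real infimum in `dirDeriv` from taking its default value. -/
theorem ConvexOn.bddBelow_slopes {q : V → ℝ} (hq : ConvexOn ℝ univ q) (h0 : q 0 = 0) (v : V) :
    BddBelow (range fun t : Ioi (0 : ℝ) => q (t.1 • v) / t.1) := by
  refine ⟨-q (-v), ?_⟩
  rintro _ ⟨⟨t, ht⟩, rfl⟩
  have ht : 0 < t := ht
  have h := hq.2 (mem_univ (t • v)) (mem_univ (-v)) (show 0 ≤ 1 / (1 + t) by positivity)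
    (show 0 ≤ t / (1 + t) by positivity) (by field_simp)
  have e : (1 / (1 + t)) • t • v + (t / (1 + t)) • -v = 0 := by
    rw [smul_smul, smul_neg]
    simp [div_eq_inv_mul]
  rw [e, h0, smul_eq_mul, smul_eq_mul] at h
  have : 0 ≤ (q (t • v) + t * q (-v)) / (1 + t) := by
    calc 0 ≤ _ := h
      _ = _ := by field_simp
  have h2 : 0 ≤ q (t • v) + t * q (-v) := by
    by_contra hc
    exact absurd this (not_le.2 (div_neg_of_neg_of_pos (not_le.1 hc) (by positivity)))
  change -q (-v) ≤ q (t • v) / t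
  rw [le_div_iff₀ ht]
  linarith

theorem ConvexOn.dirDeriv_le {q : V → ℝ} (hq : ConvexOn ℝ univ q) (h0 : q 0 = 0) (v : V) {t : ℝ}
    (ht : 0 < t) : dirDeriv q v ≤ q (t • v) / t :=
  ciInf_le (ConvexOn.bddBelow_slopes hq h0 v) (⟨t, ht⟩ : Ioi (0 : ℝ))

theorem le_dirDeriv {q : V → ℝ} {v : V} {c : ℝ} (h : ∀ t : ℝ, 0 < t → c ≤ q (t • v) / t) :
    c ≤ dirDeriv q v := by
  have : Nonempty (Ioi (0 : ℝ)) := ⟨⟨1, mem_Ioi.2 one_pos⟩⟩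
  exact le_ciInf fun t => h t.1 t.2

/-- A convex function vanishing at `0` dominates a linear functional. -/
theorem ConvexOn.exists_linearMap_le {q : V → ℝ} (hq : ConvexOn ℝ univ q) (h0 : q 0 = 0) :
    ∃ L : V →ₗ[ℝ] ℝ, ∀ v, L v ≤ q v := by
  have hsmul : ∀ c : ℝ, 0 < c → ∀ v, c * dirDeriv q v ≤ dirDeriv q (c • v) := by
    intro c hc v
    refine le_dirDeriv fun t ht => ?_
    have := ConvexOn.dirDeriv_le hq h0 v (mul_pos ht hc)
    rw [smul_smul]
    calc c * dirDeriv q v ≤ c * (q ((t * c) • v) / (t * c)) := by gcongr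
      _ = _ := by field_simp
  -- Hahn–Banach extends the zero functional on the trivial subspace below the sublinear directional
  -- derivative.
  obtain ⟨L, -, hL⟩ := exists_extension_of_le_sublinear (⟨⊥, 0⟩ : V →ₗ.[ℝ] ℝ) (dirDeriv q)
    (fun c hc v => by
      refine le_antisymm ?_ (hsmul c hc v)
      have := hsmul c⁻¹ (inv_pos.2 hc) (c • v)
      rw [smul_smul, inv_mul_cancel₀ hc.ne', one_smul] at this
      rwa [inv_mul_le_iff₀ hc] at this)
    (fun v w => by
      -- The weights t/(s+t) and s/(s+t) turn s v and t w into the same multiple st/(s+t) of v and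
      -- w. Independent s and t allow the two infima to be taken one after the other.
      have key : ∀ s t : ℝ, 0 < s → 0 < t →
          dirDeriv q (v + w) ≤ q (s • v) / s + q (t • w) / t := by
        intro s t hs ht
        have h := hq.2 (mem_univ (s • v)) (mem_univ (t • w)) (show 0 ≤ t / (s + t) by positivity)
          (show 0 ≤ s / (s + t) by positivity) (by field_simp; ring)
        have e : (t / (s + t)) • s • v + (s / (s + t)) • t • w = (s * t / (s + t)) • (v + w) := by
          rw [smul_smul, smul_smul, smul_add]
          congr 2 <;> ring
        rw [e, smul_eq_mul, smul_eq_mul] at h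
        refine (ConvexOn.dirDeriv_le hq h0 (v + w) (t := s * t / (s + t)) (by positivity)).trans ?_
        rw [div_le_iff₀ (by positivity)]
        refine h.trans (le_of_eq ?_)
        field_simp
      have h1 : ∀ s : ℝ, 0 < s → dirDeriv q (v + w) - q (s • v) / s ≤ dirDeriv q w :=
        fun s hs => le_dirDeriv fun t ht => by linarith [key s t hs ht]
      have h2 : dirDeriv q (v + w) - dirDeriv q w ≤ dirDeriv q v :=
        le_dirDeriv fun s hs => by linarith [h1 s hs]
      linarith)
    (fun x => by
      have hx : (x : V) = 0 := (Submodule.mem_bot ℝ).1 x.2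
      refine le_dirDeriv fun t _ => ?_
      simp [hx, h0])
  refine ⟨L, fun v => (hL v).trans ?_⟩
  simpa using ConvexOn.dirDeriv_le hq h0 v one_pos

end Subgradient

/-! ### Convexity and finiteness of the superhedging cost -/

/-- Functions dominated by a multiple of `Z`. -/
def dominatedBy {E : Type*} (Z : E → ℝ) : Submodule ℝ (E → ℝ) where
  carrier := {X | ∃ C : ℝ, ∀ ω, |X ω| ≤ C * Z ω}
  add_mem' := by
    rintro X Y ⟨C, hC⟩ ⟨D, hD⟩
    refine ⟨C + D, fun ω => (abs_add_le _ _).trans ?_⟩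
    rw [add_mul]
    exact add_le_add (hC ω) (hD ω)
  zero_mem' := ⟨0, fun ω => by simp⟩
  smul_mem' := by
    rintro c X ⟨C, hC⟩
    refine ⟨|c| * C, fun ω => ?_⟩
    rw [Pi.smul_apply, smul_eq_mul, abs_mul, mul_assoc]
    exact mul_le_mul_of_nonneg_left (hC ω) (abs_nonneg c)

/-- Capital from which `X` can be superhedged. -/
def hedgeCapital {E : Type*} (G : Set (E → ℝ)) (X : E → ℝ) : Set ℝ :=
  {m | ∃ g ∈ G, ∀ ω, X ω ≤ m + g ω}

/-- The real-valued superhedging cost. -/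
def hedgeCost {E : Type*} (G : Set (E → ℝ)) (X : E → ℝ) : ℝ := sInf (hedgeCapital G X)

/-- Arbitrage-free sets of gains that are convex up to free disposal and superhedge the tail of `Z`
cheaply. -/
structure IsHedgingSet {E : Type*} (Z : E → ℝ) (G : Set (E → ℝ)) : Prop where
  one_le : ∀ ω, 1 ≤ Z ω
  zero_mem : (0 : E → ℝ) ∈ G
  convex : ∀ g₁ ∈ G, ∀ g₂ ∈ G, ∀ a b : ℝ, 0 ≤ a → 0 ≤ b → a + b = 1 →
    ∃ g ∈ G, ∀ ω, a * g₁ ω + b * g₂ ω ≤ g ω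
  noArbitrage : ∀ g ∈ G, ∀ ε : ℝ, 0 < ε → ∃ ω, g ω < ε
  tail : ∀ c : ℝ, ∃ R : ℝ, ∃ g ∈ G, ∀ ω, -1 ≤ g ω ∧ (R < Z ω → c * Z ω ≤ 1 + g ω)

namespace IsHedgingSet

variable {E : Type*} {Z : E → ℝ} {G : Set (E → ℝ)}

theorem mem_combo (hG : IsHedgingSet Z G) {X Y : E → ℝ} {m n : ℝ} (hm : m ∈ hedgeCapital G X)
    (hn : n ∈ hedgeCapital G Y) {a b : ℝ} (ha : 0 ≤ a) (hb : 0 ≤ b) (hab : a + b = 1) :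
    a * m + b * n ∈ hedgeCapital G (a • X + b • Y) := by
  obtain ⟨g₁, hg₁, h₁⟩ := hm
  obtain ⟨g₂, hg₂, h₂⟩ := hn
  obtain ⟨g, hg, h⟩ := hG.convex g₁ hg₁ g₂ hg₂ a b ha hb hab
  refine ⟨g, hg, fun ω => ?_⟩
  have e1 := mul_le_mul_of_nonneg_left (h₁ ω) ha
  have e2 := mul_le_mul_of_nonneg_left (h₂ ω) hb
  have e3 := h ω
  simp only [Pi.add_apply, Pi.smul_apply, smul_eq_mul]
  linarith

theorem nonneg_of_mem_zero (hG : IsHedgingSet Z G) {m : ℝ} (hm : m ∈ hedgeCapital G 0) : 0 ≤ m := by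
  by_contra hneg
  obtain ⟨g, hg, h⟩ := hm
  obtain ⟨ω, hω⟩ := hG.noArbitrage g hg (-m) (by linarith)
  have := h ω
  simp only [Pi.zero_apply] at this
  linarith

theorem mem_mono {X Y : E → ℝ} (hXY : ∀ ω, X ω ≤ Y ω) {m : ℝ} (hm : m ∈ hedgeCapital G Y) :
    m ∈ hedgeCapital G X := by
  obtain ⟨g, hg, h⟩ := hm
  exact ⟨g, hg, fun ω => (hXY ω).trans (h ω)⟩

theorem mem_add_const {X : E → ℝ} {m : ℝ} (hm : m ∈ hedgeCapital G X) (c : ℝ) :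
    m + c ∈ hedgeCapital G (fun ω => X ω + c) := by
  obtain ⟨g, hg, h⟩ := hm
  exact ⟨g, hg, fun ω => by linarith [h ω]⟩

theorem nonempty (hG : IsHedgingSet Z G) {X : E → ℝ} (hX : X ∈ dominatedBy Z) :
    (hedgeCapital G X).Nonempty := by
  obtain ⟨C, hC⟩ := hX
  obtain ⟨R, g, hg, h⟩ := hG.tail C
  -- Where Z ≤ R, the term |C||R| covers C Z and the 1 covers g ≥ −1; where Z > R, the tail hedge 1
  -- + g suffices.
  refine ⟨|C| * |R| + 1, g, hg, fun ω => ?_⟩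
  have h1 := (le_abs_self _).trans (hC ω)
  obtain ⟨h2, h3⟩ := h ω
  have hpos : 0 ≤ |C| * |R| := by positivity
  rcases lt_or_ge R (Z ω) with hR | hR
  · linarith [h3 hR]
  · have hZ0 : 0 ≤ Z ω := zero_le_one.trans (hG.one_le ω)
    have : C * Z ω ≤ |C| * |R| := by
      calc C * Z ω ≤ |C| * Z ω := by gcongr; exact le_abs_self C
        _ ≤ _ := by gcongr; exact hR.trans (le_abs_self R)
    linarith

/-- Averaging hedges of X and −X superhedges 0 from capital (m + n)/2, which absence of arbitrage
makes non-negative. Hence any hedge of −X bounds the capitals for X from below. -/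
theorem add_nonneg_of_mem (hG : IsHedgingSet Z G) {X : E → ℝ} {m n : ℝ}
    (hm : m ∈ hedgeCapital G X) (hn : n ∈ hedgeCapital G (-X)) : 0 ≤ m + n := by
  have h := hG.mem_combo hm hn (a := 1 / 2) (b := 1 / 2) (by norm_num) (by norm_num) (by norm_num)
  have e : ((1 / 2 : ℝ) • X + (1 / 2 : ℝ) • -X) = 0 := by
    rw [smul_neg, add_neg_cancel]
  rw [e] at h
  have := hG.nonneg_of_mem_zero h
  linarith

theorem bddBelow (hG : IsHedgingSet Z G) {X : E → ℝ} (hX : X ∈ dominatedBy Z) :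
    BddBelow (hedgeCapital G X) := by
  obtain ⟨n, hn⟩ := hG.nonempty (Submodule.neg_mem _ hX)
  exact ⟨-n, fun m hm => by linarith [hG.add_nonneg_of_mem hm hn]⟩

theorem cost_le (hG : IsHedgingSet Z G) {X : E → ℝ} (hX : X ∈ dominatedBy Z) {m : ℝ}
    (hm : m ∈ hedgeCapital G X) : hedgeCost G X ≤ m := csInf_le (hG.bddBelow hX) hm

theorem cost_mono (hG : IsHedgingSet Z G) {X Y : E → ℝ} (hX : X ∈ dominatedBy Z)
    (hY : Y ∈ dominatedBy Z) (h : ∀ ω, X ω ≤ Y ω) : hedgeCost G X ≤ hedgeCost G Y :=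
  le_csInf (hG.nonempty hY) fun _ hm => hG.cost_le hX (mem_mono h hm)

theorem cost_zero (hG : IsHedgingSet Z G) : hedgeCost G 0 = 0 := by
  refine le_antisymm (hG.cost_le (Submodule.zero_mem _) ⟨0, hG.zero_mem, fun ω => by simp⟩) ?_
  exact le_csInf (hG.nonempty (Submodule.zero_mem _)) fun _ hm => hG.nonneg_of_mem_zero hm

theorem cost_gain_nonpos (hG : IsHedgingSet Z G) {g : E → ℝ} (hg : g ∈ G)
    (hgZ : g ∈ dominatedBy Z) : hedgeCost G g ≤ 0 :=
  hG.cost_le hgZ ⟨g, hg, fun ω => by simp⟩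

theorem cost_combo (hG : IsHedgingSet Z G) {X Y : E → ℝ} (hX : X ∈ dominatedBy Z)
    (hY : Y ∈ dominatedBy Z) {a b : ℝ} (ha : 0 ≤ a) (hb : 0 ≤ b) (hab : a + b = 1) :
    hedgeCost G (a • X + b • Y) ≤ a * hedgeCost G X + b * hedgeCost G Y := by
  refine le_of_forall_pos_le_add fun ε hε => ?_
  obtain ⟨m, hm, hm'⟩ := exists_lt_of_csInf_lt (hG.nonempty hX) (lt_add_of_pos_right _ hε)
  obtain ⟨n, hn, hn'⟩ := exists_lt_of_csInf_lt (hG.nonempty hY) (lt_add_of_pos_right _ hε)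
  have h := hG.cost_le (Submodule.add_mem _ (Submodule.smul_mem _ a hX)
    (Submodule.smul_mem _ b hY)) (hG.mem_combo hm hn ha hb hab)
  have e1 := mul_le_mul_of_nonneg_left hm'.le ha
  have e2 := mul_le_mul_of_nonneg_left hn'.le hb
  have e3 : a * ε + b * ε = ε := by rw [← add_mul, hab, one_mul]
  unfold hedgeCost at *
  linarith

theorem const_mem (hG : IsHedgingSet Z G) (c : ℝ) : (fun _ => c : E → ℝ) ∈ dominatedBy Z :=
  ⟨|c|, fun ω => le_mul_of_one_le_right (abs_nonneg c) (hG.one_le ω)⟩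

theorem cost_add_const_le (hG : IsHedgingSet Z G) {X : E → ℝ} (hX : X ∈ dominatedBy Z) (c : ℝ) :
    hedgeCost G (X + fun _ => c) ≤ hedgeCost G X + c := by
  have : hedgeCost G (X + fun _ => c) - c ≤ hedgeCost G X :=
    le_csInf (hG.nonempty hX) fun m hm => by
      have := hG.cost_le (Submodule.add_mem _ hX (hG.const_mem c)) (mem_add_const hm c)
      linarith
  linarith

/-- A positive normalized subgradient of the superhedging cost. -/
theorem exists_subgradient (hG : IsHedgingSet Z G) {X : E → ℝ} (hX : X ∈ dominatedBy Z) :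
    ∃ L : dominatedBy Z →ₗ[ℝ] ℝ,
      ∀ Y : dominatedBy Z, L Y ≤ hedgeCost G (X + Y) - hedgeCost G X := by
  refine ConvexOn.exists_linearMap_le
    (q := fun Y : dominatedBy Z => hedgeCost G (X + Y) - hedgeCost G X)
    ⟨convex_univ, ?_⟩ (by simp)
  intro Y _ W _ a b ha hb hab
  have h := hG.cost_combo (Submodule.add_mem _ hX Y.2) (Submodule.add_mem _ hX W.2) ha hb hab
  have e : a • (X + (Y : E → ℝ)) + b • (X + (W : E → ℝ))
      = X + ((a • Y + b • W : dominatedBy Z) : E → ℝ) := by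
    have : X = a • X + b • X := by rw [← add_smul, hab, one_smul]
    conv_rhs => rw [this]
    push_cast
    simp only [smul_add]
    abel
  rw [e] at h
  have e2 : a * hedgeCost G X + b * hedgeCost G X = hedgeCost G X := by
    rw [← add_mul, hab, one_mul]
  simp only [smul_eq_mul]
  linarith

end IsHedgingSet

/-! ### Lipschitz approximation of upper semicontinuous functions from above -/

section UpperEnvelope

variable {E : Type*} [PseudoMetricSpace E]

/-- The upper Lipschitz envelope of `f` with constant `n`. -/
def lipEnvelope (f : E → ℝ) (n : ℝ) (x : E) : ℝ := ⨆ y, (f y - n * dist x y)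

theorem bddAbove_lipEnvelope {f : E → ℝ} (hf : ∀ x, f x ≤ 0) {n : ℝ} (hn : 0 ≤ n) (x : E) :
    BddAbove (range fun y => f y - n * dist x y) := by
  refine ⟨0, ?_⟩
  rintro _ ⟨y, rfl⟩
  have : 0 ≤ n * dist x y := by positivity
  have := hf y
  dsimp only
  linarith

theorem le_lipEnvelope {f : E → ℝ} (hf : ∀ x, f x ≤ 0) {n : ℝ} (hn : 0 ≤ n) (x : E) :
    f x ≤ lipEnvelope f n x := by
  simpa [lipEnvelope] using le_ciSup (bddAbove_lipEnvelope hf hn x) x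

theorem lipEnvelope_le {f : E → ℝ} {n : ℝ} {x : E} {c : ℝ} (h : ∀ y, f y - n * dist x y ≤ c) :
    lipEnvelope f n x ≤ c :=
  have : Nonempty E := ⟨x⟩
  ciSup_le h

theorem lipEnvelope_nonpos {f : E → ℝ} (hf : ∀ x, f x ≤ 0) {n : ℝ} (hn : 0 ≤ n) (x : E) :
    lipEnvelope f n x ≤ 0 := by
  refine lipEnvelope_le fun y => ?_
  have : 0 ≤ n * dist x y := by positivity
  have := hf y
  linarith

theorem continuous_lipEnvelope {f : E → ℝ} (hf : ∀ x, f x ≤ 0) {n : ℝ} (hn : 0 ≤ n) :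
    Continuous (lipEnvelope f n) := by
  refine (LipschitzWith.of_le_add_mul (Real.toNNReal n) fun x z => ?_).continuous
  refine lipEnvelope_le fun y => ?_
  rw [Real.coe_toNNReal n hn]
  have h1 := le_ciSup (bddAbove_lipEnvelope hf hn z) y
  have h2 := mul_le_mul_of_nonneg_left (dist_triangle_left z y x) hn
  change f y - n * dist z y ≤ lipEnvelope f n z at h1
  linarith

theorem UpperSemicontinuous.tendsto_lipEnvelope {f : E → ℝ} (hu : UpperSemicontinuous f)
    (hf : ∀ x, f x ≤ 0) (x : E) :
    Tendsto (fun n : ℕ => lipEnvelope f n x) atTop (𝓝 (f x)) := by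
  rw [Metric.tendsto_atTop]
  intro ε hε
  obtain ⟨δ, hδ, hball⟩ := Metric.eventually_nhds_iff.1 (hu x (f x + ε / 2) (by linarith))
  -- Within distance δ semicontinuity bounds f(y); farther away f(y) ≤ 0, and the penalty n δ ≥
  -- −f(x) brings the value down to f(x).
  obtain ⟨N, hN⟩ := exists_nat_ge (-f x / δ)
  refine ⟨N, fun n hn => ?_⟩
  have hn0 : (0 : ℝ) ≤ n := Nat.cast_nonneg n
  have hle : lipEnvelope f n x ≤ f x + ε / 2 := by
    refine lipEnvelope_le fun y => ?_
    rcases lt_or_ge (dist y x) δ with h | h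
    · have := hball h
      have : 0 ≤ (n : ℝ) * dist x y := by positivity
      linarith
    · rw [dist_comm] at h
      have h1 : -f x ≤ N * δ := (div_le_iff₀ hδ).1 hN
      have h2 : (N : ℝ) * δ ≤ n * dist x y := by
        gcongr
      have := hf y
      linarith
  have hge := le_lipEnvelope hf hn0 x
  rw [Real.dist_eq, abs_lt]
  constructor <;> linarith

end UpperEnvelope

/-! ### Cutoffs along sublevel sets -/

section Cutoff

variable {E : Type*} {Z : E → ℝ}

/-- A cutoff function equal to `1` on `Z ≤ n` and to `0` on `Z ≥ n + 1`. -/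
def cutoff (Z : E → ℝ) (n : ℕ) (ω : E) : ℝ := max 0 (min 1 (n + 1 - Z ω))

theorem cutoff_nonneg (n : ℕ) (ω : E) : 0 ≤ cutoff Z n ω := le_max_left _ _

theorem cutoff_le_one (n : ℕ) (ω : E) : cutoff Z n ω ≤ 1 :=
  max_le zero_le_one (min_le_left _ _)

theorem cutoff_eq_one {n : ℕ} {ω : E} (h : Z ω ≤ n) : cutoff Z n ω = 1 := by
  unfold cutoff
  rw [min_eq_left (by linarith), max_eq_right zero_le_one]

theorem cutoff_eq_zero {n : ℕ} {ω : E} (h : n + 1 ≤ Z ω) : cutoff Z n ω = 0 := by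
  unfold cutoff
  rw [max_eq_left]
  exact (min_le_right _ _).trans (by linarith)

theorem eventually_cutoff_eq_one (ω : E) : ∀ᶠ n in atTop, cutoff Z n ω = 1 := by
  obtain ⟨N, hN⟩ := exists_nat_ge (Z ω)
  filter_upwards [eventually_ge_atTop N] with n hn
  exact cutoff_eq_one (hN.trans (by exact_mod_cast hn))

theorem tendsto_mul_cutoff (Y : E → ℝ) (ω : E) :
    Tendsto (fun n => Y ω * cutoff Z n ω) atTop (𝓝 (Y ω)) := by
  refine tendsto_const_nhds.congr' ?_
  filter_upwards [eventually_cutoff_eq_one (Z := Z) ω] with n hn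
  rw [hn, mul_one]

theorem mul_cutoff_mem {Y : E → ℝ} (hY : Y ∈ dominatedBy Z) (n : ℕ) :
    (fun ω => Y ω * cutoff Z n ω) ∈ dominatedBy Z := by
  obtain ⟨C, hC⟩ := hY
  refine ⟨C, fun ω => ?_⟩
  rw [abs_mul, abs_of_nonneg (cutoff_nonneg n ω)]
  exact (mul_le_of_le_one_right (abs_nonneg _) (cutoff_le_one n ω)).trans (hC ω)

variable [TopologicalSpace E]

theorem continuous_cutoff (hZ : Continuous Z) (n : ℕ) : Continuous (cutoff Z n) :=
  continuous_const.max (continuous_const.min (continuous_const.sub hZ))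

theorem hasCompactSupport_cutoff [T2Space E] (hK : ∀ R : ℝ, IsCompact {ω | Z ω ≤ R}) (n : ℕ) :
    HasCompactSupport (cutoff Z n) :=
  HasCompactSupport.intro (hK (n + 1)) fun _ hω => cutoff_eq_zero (not_le.1 hω).le

theorem mem_dominatedBy_of_hasCompactSupport {Y : E → ℝ} (h1 : ∀ ω, 1 ≤ Z ω) (hY : Continuous Y)
    (hc : HasCompactSupport Y) : Y ∈ dominatedBy Z := by
  obtain ⟨C, hC⟩ := hc.exists_bound_of_continuous hY
  refine ⟨C, fun ω => ?_⟩
  have h0 := (abs_nonneg _).trans (hC ω)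
  exact (hC ω).trans (le_mul_of_one_le_right h0 (h1 ω))

end Cutoff

/-! ### Riesz representation of tight positive functionals -/

section Representation

variable {E : Type*} [TopologicalSpace E] [T2Space E] [LocallyCompactSpace E] [MeasurableSpace E]
  [BorelSpace E] {Z : E → ℝ}

/-- The restriction of a positive functional to compactly supported continuous functions. -/
def restrictCc (h1 : ∀ ω, 1 ≤ Z ω) (L : dominatedBy Z →ₗ[ℝ] ℝ)
    (hL : ∀ Y : dominatedBy Z, (∀ ω, 0 ≤ Y.1 ω) → 0 ≤ L Y) :
    CompactlySupportedContinuousMap E ℝ →ₚ[ℝ] ℝ :=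
  PositiveLinearMap.mk₀
    { toFun := fun f =>
        L ⟨f, mem_dominatedBy_of_hasCompactSupport h1 f.1.continuous f.hasCompactSupport⟩
      map_add' := fun f g => by rw [← map_add]; rfl
      map_smul' := fun c f => by rw [RingHom.id_apply, ← map_smul]; rfl }
    fun f hf => hL _ fun ω => hf ω

/-- Positive tight functionals on functions dominated by `Z` are represented by probability
measures on continuous functions. -/
theorem exists_probabilityMeasure (hZ : Continuous Z) (h1 : ∀ ω, 1 ≤ Z ω)
    (hK : ∀ R : ℝ, IsCompact {ω | Z ω ≤ R}) (L : dominatedBy Z →ₗ[ℝ] ℝ)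
    (hL : ∀ Y : dominatedBy Z, (∀ ω, 0 ≤ Y.1 ω) → 0 ≤ L Y)
    (hL1 : ∀ Y : dominatedBy Z, (∀ ω, Y.1 ω = 1) → L Y = 1)
    (htail : ∀ ε : ℝ, 0 < ε → ∃ R : ℝ, ∀ Y : dominatedBy Z, (∀ ω, Y.1 ω ≤ Z ω) →
      (∀ ω, Z ω ≤ R → Y.1 ω ≤ 0) → L Y ≤ ε) :
    ∃ P : ProbabilityMeasure E, Integrable Z (P : Measure E) ∧
      ∀ Y : dominatedBy Z, Continuous Y.1 → ∫ ω, Y.1 ω ∂(P : Measure E) = L Y := by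
  have hmono : ∀ Y W : dominatedBy Z, (∀ ω, Y.1 ω ≤ W.1 ω) → L Y ≤ L W := fun Y W h => by
    have := hL (W - Y) fun ω => sub_nonneg.2 (h ω)
    rw [map_sub] at this
    linarith
  have hZ0 : ∀ ω, 0 ≤ Z ω := fun ω => zero_le_one.trans (h1 ω)
  let ZZ : dominatedBy Z := ⟨Z, 1, fun ω => by rw [abs_of_nonneg (hZ0 ω), one_mul]⟩
  let cut : dominatedBy Z → ℕ → dominatedBy Z := fun Y n => ⟨_, mul_cutoff_mem Y.2 n⟩
  let μ := RealRMK.rieszMeasure (restrictCc h1 L hL)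
  have hsupp : ∀ (Y : dominatedBy Z) (n : ℕ), HasCompactSupport fun ω => Y.1 ω * cutoff Z n ω :=
    fun Y n => (hasCompactSupport_cutoff hK n).mul_left
  have hcont : ∀ Y : dominatedBy Z, Continuous Y.1 → ∀ n : ℕ,
      Continuous fun ω => Y.1 ω * cutoff Z n ω := fun Y hY n => hY.mul (continuous_cutoff hZ n)
  have hint : ∀ Y : dominatedBy Z, Continuous Y.1 → ∀ n : ℕ,
      ∫ ω, Y.1 ω * cutoff Z n ω ∂μ = L (cut Y n) := fun Y hY n =>
    RealRMK.integral_rieszMeasure (restrictCc h1 L hL) ⟨⟨_, hcont Y hY n⟩, hsupp Y n⟩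
  have hIcut : ∀ Y : dominatedBy Z, Continuous Y.1 → ∀ n : ℕ,
      Integrable (fun ω => Y.1 ω * cutoff Z n ω) μ := fun Y hY n =>
    (hcont Y hY n).integrable_of_hasCompactSupport (hsupp Y n)
  -- Fatou along the cutoffs: the integral of Z χₙ is L(Z χₙ) ≤ L(Z).
  have hZint : Integrable Z μ := by
    refine ⟨hZ.aestronglyMeasurable, ?_⟩
    rw [hasFiniteIntegral_iff_ofReal (Eventually.of_forall hZ0)]
    refine lt_of_le_of_lt ?_ (ENNReal.ofReal_lt_top (r := L ZZ))
    have hlim : ∀ ω, liminf (fun n : ℕ => ENNReal.ofReal (Z ω * cutoff Z n ω)) atTop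
        = ENNReal.ofReal (Z ω) := fun ω =>
      ((ENNReal.continuous_ofReal.tendsto _).comp (tendsto_mul_cutoff Z ω)).liminf_eq
    calc ∫⁻ ω, ENNReal.ofReal (Z ω) ∂μ
        = ∫⁻ ω, liminf (fun n : ℕ => ENNReal.ofReal (Z ω * cutoff Z n ω)) atTop ∂μ := by
          simp_rw [hlim]
      _ ≤ liminf (fun n : ℕ => ∫⁻ ω, ENNReal.ofReal (Z ω * cutoff Z n ω) ∂μ) atTop :=
          lintegral_liminf_le fun n => (hcont ZZ hZ n).measurable.ennreal_ofReal
      _ ≤ ENNReal.ofReal (L ZZ) := by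
          refine liminf_le_of_frequently_le' (Frequently.of_forall fun n => ?_)
          rw [← ofReal_integral_eq_lintegral_ofReal (hIcut ZZ hZ n)
            (Eventually.of_forall fun ω => mul_nonneg (hZ0 ω) (cutoff_nonneg n ω))]
          refine ENNReal.ofReal_le_ofReal ?_
          rw [hint ZZ hZ n]
          exact hmono _ _ fun ω => mul_le_of_le_one_right (hZ0 ω) (cutoff_le_one n ω)
  -- Tightness: Z − Z χₙ lies below Z and vanishes on Z ≤ n. Since |Y − Y χₙ| ≤ C (Z − Z χₙ), this
  -- controls the remainder of every dominated Y.
  have hrem : Tendsto (fun n => L (ZZ - cut ZZ n)) atTop (𝓝 0) := by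
    rw [Metric.tendsto_atTop]
    intro ε hε
    obtain ⟨R, hR⟩ := htail (ε / 2) (by linarith)
    obtain ⟨N, hN⟩ := exists_nat_ge R
    refine ⟨N, fun n hn => ?_⟩
    have h0 : 0 ≤ L (ZZ - cut ZZ n) := hL _ fun ω =>
      sub_nonneg.2 (mul_le_of_le_one_right (hZ0 ω) (cutoff_le_one n ω))
    have h2 := hR (ZZ - cut ZZ n)
      (fun ω => sub_le_self _ (mul_nonneg (hZ0 ω) (cutoff_nonneg n ω)))
      (fun ω hω => by
        have hc : cutoff Z n ω = 1 :=
          cutoff_eq_one (hω.trans (hN.trans (by exact_mod_cast hn)))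
        change Z ω - Z ω * cutoff Z n ω ≤ 0
        rw [hc]
        simp)
    rw [Real.dist_eq, sub_zero, abs_of_nonneg h0]
    linarith
  have hrep : ∀ Y : dominatedBy Z, Continuous Y.1 → ∫ ω, Y.1 ω ∂μ = L Y := by
    intro Y hY
    obtain ⟨C, hC⟩ := Y.2
    have t1 : Tendsto (fun n => ∫ ω, Y.1 ω * cutoff Z n ω ∂μ) atTop (𝓝 (∫ ω, Y.1 ω ∂μ)) := by
      refine tendsto_integral_of_dominated_convergence (fun ω => C * Z ω)
        (fun n => (hcont Y hY n).aestronglyMeasurable) (hZint.const_mul C)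
        (fun n => Eventually.of_forall fun ω => ?_)
        (Eventually.of_forall fun ω => tendsto_mul_cutoff Y.1 ω)
      rw [norm_mul, Real.norm_eq_abs, Real.norm_eq_abs, abs_of_nonneg (cutoff_nonneg n ω)]
      exact (mul_le_of_le_one_right (abs_nonneg _) (cutoff_le_one n ω)).trans (hC ω)
    have t2 : Tendsto (fun n => L (Y - cut Y n)) atTop (𝓝 0) := by
      have t3 := hrem.const_mul C
      rw [mul_zero] at t3
      have hb : ∀ n ω, |Y.1 ω - Y.1 ω * cutoff Z n ω| ≤ C * (Z ω - Z ω * cutoff Z n ω) := by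
        intro n ω
        have e : Y.1 ω - Y.1 ω * cutoff Z n ω = Y.1 ω * (1 - cutoff Z n ω) := by ring
        have hn : 0 ≤ 1 - cutoff Z n ω := sub_nonneg.2 (cutoff_le_one n ω)
        rw [e, abs_mul, abs_of_nonneg hn]
        calc _ ≤ C * Z ω * (1 - cutoff Z n ω) := mul_le_mul_of_nonneg_right (hC ω) hn
          _ = _ := by ring
      refine squeeze_zero_norm (fun n => ?_) t3
      rw [Real.norm_eq_abs, abs_le, ← smul_eq_mul, ← map_smul, ← map_neg]
      exact ⟨hmono _ _ fun ω => neg_le_of_abs_le (hb n ω),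
        hmono _ _ fun ω => le_of_abs_le (hb n ω)⟩
    have t4 : Tendsto (fun n => L (cut Y n)) atTop (𝓝 (L Y)) := by
      have := t2.const_sub (L Y)
      rw [sub_zero] at this
      refine this.congr fun n => ?_
      rw [map_sub]
      ring
    simp_rw [hint Y hY] at t1
    exact tendsto_nhds_unique t1 t4
  have hμ : IsProbabilityMeasure μ := by
    have hone := hrep ⟨fun _ => 1, 1, fun ω => by simpa using h1 ω⟩ continuous_const
    rw [hL1 _ fun _ => rfl] at hone
    simp only [integral_const, smul_eq_mul, mul_one, Measure.real] at hone
    exact ⟨by rw [← ENNReal.toReal_eq_one_iff]; exact hone⟩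
  exact ⟨⟨μ, hμ⟩, hZint, hrep⟩

end Representation

/-! ### Tightness of subgradients and dual attainment -/

namespace IsHedgingSet

variable {E : Type*} {Z : E → ℝ} {G : Set (E → ℝ)}

/-- Tail bound for subgradients of the superhedging cost. -/
theorem exists_tail_le (hG : IsHedgingSet Z G) {X : E → ℝ} (hX : X ∈ dominatedBy Z)
    {L : dominatedBy Z →ₗ[ℝ] ℝ}
    (hL : ∀ Y : dominatedBy Z, L Y ≤ hedgeCost G (X + Y) - hedgeCost G X) {ε : ℝ} (hε : 0 < ε) :
    ∃ R : ℝ, ∀ Y : dominatedBy Z, (∀ ω, Y.1 ω ≤ Z ω) → (∀ ω, Z ω ≤ R → Y.1 ω ≤ 0) → L Y ≤ ε := by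
  -- Write X + cY as the midpoint of 2X and 2cY. The tail hedge makes the cost of 2cY at most 1, so
  -- c L(Y) ≤ B for a bound B independent of c; then c is chosen so large that B ≤ c ε.
  set B : ℝ := (1 / 2) * hedgeCost G ((2 : ℝ) • X) + 1 / 2 - hedgeCost G X with hB
  set c : ℝ := (|B| + 1) / ε with hc
  have hc0 : 0 < c := by positivity
  obtain ⟨R, g, hg, h⟩ := hG.tail (2 * c)
  refine ⟨R, fun Y hYZ hYR => ?_⟩
  have hm : (1 : ℝ) ∈ hedgeCapital G ((2 * c) • Y.1) := by
    refine ⟨g, hg, fun ω => ?_⟩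
    obtain ⟨h2, h3⟩ := h ω
    simp only [Pi.smul_apply, smul_eq_mul]
    rcases lt_or_ge R (Z ω) with hR | hR
    · exact (mul_le_mul_of_nonneg_left (hYZ ω) (by positivity)).trans (h3 hR)
    · have := mul_nonpos_of_nonneg_of_nonpos (show 0 ≤ 2 * c by positivity) (hYR ω hR)
      linarith
  have h1 := hG.cost_le (Submodule.smul_mem _ (2 * c) Y.2) hm
  have h2 := hG.cost_combo (Submodule.smul_mem _ (2 : ℝ) hX) (Submodule.smul_mem _ (2 * c) Y.2)
    (a := 1 / 2) (b := 1 / 2) (by norm_num) (by norm_num) (by norm_num)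
  have h3 := hL (c • Y)
  have e : (1 / 2 : ℝ) • (2 : ℝ) • X + (1 / 2 : ℝ) • (2 * c) • Y.1
      = X + ((c • Y : dominatedBy Z) : E → ℝ) := by
    ext ω
    simp only [Pi.add_apply, Pi.smul_apply, smul_eq_mul, Submodule.coe_smul]
    ring
  rw [e] at h2
  rw [map_smul, smul_eq_mul] at h3
  have h4 : c * L Y ≤ B := by linarith
  have h5 : c * L Y ≤ c * ε := by
    have : c * ε = |B| + 1 := by rw [hc]; field_simp
    linarith [le_abs_self B]
  exact le_of_mul_le_mul_left h5 hc0

/-- Dual attainment for upper semicontinuous claims. -/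
theorem exists_dual [MetricSpace E] [LocallyCompactSpace E] [MeasurableSpace E] [BorelSpace E]
    (hG : IsHedgingSet Z G) (hZ : Continuous Z) (hK : ∀ R : ℝ, IsCompact {ω | Z ω ≤ R})
    {X : E → ℝ} (hX : X ∈ dominatedBy Z) (hu : UpperSemicontinuous X) :
    ∃ P : ProbabilityMeasure E, Integrable Z (P : Measure E) ∧
      ∀ g ∈ G, Continuous g → g ∈ dominatedBy Z →
        ∫ ω, g ω ∂(P : Measure E) ≤ ∫ ω, X ω ∂(P : Measure E) - hedgeCost G X := by
  obtain ⟨L, hL⟩ := hG.exists_subgradient hX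
  -- Test the subgradient inequality in direction −Y, along which the cost does not increase.
  have hLpos : ∀ Y : dominatedBy Z, (∀ ω, 0 ≤ Y.1 ω) → 0 ≤ L Y := by
    intro Y hY
    have h1 := hL (-Y)
    have h2 := hG.cost_mono (Submodule.add_mem _ hX (-Y).2) hX fun ω => by
      simpa using hY ω
    rw [map_neg] at h1
    linarith
  have hmono : ∀ Y W : dominatedBy Z, (∀ ω, Y.1 ω ≤ W.1 ω) → L Y ≤ L W := fun Y W h => by
    have := hLpos (W - Y) fun ω => sub_nonneg.2 (h ω)
    rw [map_sub] at this
    linarith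
  have hconst : ∀ c : ℝ, L ⟨fun _ => c, hG.const_mem c⟩ ≤ c := fun c => by
    have h1 := hL ⟨fun _ => c, hG.const_mem c⟩
    have h2 := hG.cost_add_const_le hX c
    simp only at h1
    linarith
  have hL1 : ∀ Y : dominatedBy Z, (∀ ω, Y.1 ω = 1) → L Y = 1 := by
    intro Y hY
    have e1 : Y = ⟨fun _ => 1, hG.const_mem 1⟩ := Subtype.ext (funext hY)
    have e2 : -Y = ⟨fun _ => -1, hG.const_mem (-1)⟩ :=
      Subtype.ext (funext fun ω => congrArg Neg.neg (hY ω))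
    have h1 := hconst 1
    have h2 := hconst (-1)
    rw [← e1] at h1
    rw [← e2, map_neg] at h2
    linarith
  obtain ⟨P, hP, hrep⟩ := exists_probabilityMeasure hZ hG.one_le hK L hLpos hL1
    fun ε hε => hG.exists_tail_le hX hL hε
  refine ⟨P, hP, fun g hg hgc hgZ => ?_⟩
  obtain ⟨C, hC⟩ := hX
  have hCZ : (fun ω => C * Z ω) ∈ dominatedBy Z := ⟨|C|, fun ω => by
    rw [abs_mul, abs_of_nonneg (zero_le_one.trans (hG.one_le ω))]⟩
  -- Subtracting the continuous C Z makes the function non-positive, so its envelopes are finite and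
  -- trapped between −2CZ and 0, and dominated convergence applies.
  set f : E → ℝ := fun ω => X ω + -(C * Z ω) with hf
  have hf0 : ∀ ω, f ω ≤ 0 := fun ω => by
    have := (le_abs_self _).trans (hC ω)
    simp only [hf]
    linarith
  have hfu : UpperSemicontinuous f :=
    hu.add (continuous_const.mul hZ).neg.upperSemicontinuous
  have hflow : ∀ ω, -(2 * C * Z ω) ≤ f ω := fun ω => by
    have := neg_le_of_abs_le (hC ω)
    simp only [hf]
    linarith
  have habs : ∀ (n : ℕ) ω, |lipEnvelope f n ω| ≤ 2 * C * Z ω := fun n ω => by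
    have h1 := le_lipEnvelope hf0 (Nat.cast_nonneg n) ω
    have h2 := lipEnvelope_nonpos hf0 (Nat.cast_nonneg (α := ℝ) n) ω
    rw [abs_of_nonpos h2]
    linarith [hflow ω]
  have hlim : Tendsto (fun n : ℕ => ∫ ω, lipEnvelope f n ω ∂(P : Measure E)) atTop
      (𝓝 (∫ ω, f ω ∂(P : Measure E))) :=
    tendsto_integral_of_dominated_convergence (fun ω => 2 * C * Z ω)
      (fun n => (continuous_lipEnvelope hf0 (Nat.cast_nonneg n)).aestronglyMeasurable)
      (hP.const_mul _) (fun n => Eventually.of_forall (habs n))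
      (Eventually.of_forall (UpperSemicontinuous.tendsto_lipEnvelope hfu hf0))
  have hle : L ⟨X, C, hC⟩ ≤ ∫ ω, X ω ∂(P : Measure E) := by
    have hXint : Integrable X (P : Measure E) :=
      (hP.const_mul C).mono' hu.measurable.aestronglyMeasurable (Eventually.of_forall hC)
    have hfint : ∫ ω, f ω ∂(P : Measure E)
        = ∫ ω, X ω ∂(P : Measure E) - L ⟨_, hCZ⟩ := by
      rw [← hrep ⟨_, hCZ⟩ (continuous_const.mul hZ), ← integral_sub hXint (hP.const_mul C)]
      rfl
    have : L ⟨X, C, hC⟩ - L ⟨_, hCZ⟩ ≤ ∫ ω, f ω ∂(P : Measure E) := by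
      refine ge_of_tendsto' hlim fun n => ?_
      have hmem : lipEnvelope f n ∈ dominatedBy Z := ⟨_, habs n⟩
      rw [hrep ⟨_, hmem⟩ (continuous_lipEnvelope hf0 (Nat.cast_nonneg n)), ← map_sub]
      exact hmono _ _ fun ω => le_lipEnvelope hf0 (Nat.cast_nonneg n) ω
    linarith
  -- In direction g − X the cost moves from φ(X) to φ(g) ≤ 0, so L(g) ≤ L(X) − φ(X).
  have hgX := hL (⟨g, hgZ⟩ - ⟨X, C, hC⟩)
  rw [map_sub, ← hrep ⟨g, hgZ⟩ hgc] at hgX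
  have hsum : X + ((⟨g, hgZ⟩ - ⟨X, C, hC⟩ : dominatedBy Z) : E → ℝ) = g := by
    ext ω
    simp
  rw [hsum] at hgX
  have := hG.cost_gain_nonpos hg hgZ
  dsimp only at hgX
  linarith

end IsHedgingSet

/-! ### Extended expectation -/

section Expectation

variable {E : Type*} [MeasurableSpace E]

theorem expect_of_integrable (P : ProbabilityMeasure E) {X : E → ℝ}
    (hX : Integrable X (P : Measure E)) :
    expect P X = ((∫ ω, X ω ∂(P : Measure E) : ℝ) : EReal) := by
  have h1 : ∫⁻ ω, ENNReal.ofReal (X ω) ∂(P : Measure E) < ⊤ := hX.lintegral_lt_top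
  have h2 : ∫⁻ ω, ENNReal.ofReal (-X ω) ∂(P : Measure E) < ⊤ := hX.neg.lintegral_lt_top
  rw [expect, if_pos h2, integral_eq_lintegral_pos_part_sub_lintegral_neg_part hX, EReal.coe_sub,
    EReal.coe_ennreal_toReal h1.ne, EReal.coe_ennreal_toReal h2.ne]

theorem expect_eq_bot {P : ProbabilityMeasure E} {X : E → ℝ}
    (h : ¬ ∫⁻ ω, ENNReal.ofReal (-X ω) ∂(P : Measure E) < ⊤) : expect P X = ⊥ := by
  rw [expect, if_neg h]

/-- An integrable minorant makes the negative part of Y integrable, so the convention −∞ does not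
intervene. -/
theorem expect_mono_of_integrable {P : ProbabilityMeasure E} {X Y : E → ℝ}
    (hX : Integrable X (P : Measure E)) (h : ∀ ω, X ω ≤ Y ω) :
    ((∫ ω, X ω ∂(P : Measure E) : ℝ) : EReal) ≤ expect P Y := by
  have hle : ∫⁻ ω, ENNReal.ofReal (-Y ω) ∂(P : Measure E)
      ≤ ∫⁻ ω, ENNReal.ofReal (-X ω) ∂(P : Measure E) :=
    lintegral_mono fun ω => ENNReal.ofReal_le_ofReal (neg_le_neg (h ω))
  have hXlt : ∫⁻ ω, ENNReal.ofReal (-X ω) ∂(P : Measure E) < ⊤ := hX.neg.lintegral_lt_top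
  have hlt := lt_of_le_of_lt hle hXlt
  rw [← expect_of_integrable P hX, expect, expect, if_pos hlt, if_pos hXlt]
  refine EReal.sub_le_sub ?_ ?_
  · exact EReal.coe_ennreal_le_coe_ennreal_iff.2
      (lintegral_mono fun ω => ENNReal.ofReal_le_ofReal (h ω))
  · exact EReal.coe_ennreal_le_coe_ennreal_iff.2 hle

theorem expect_pos {P : ProbabilityMeasure E} {X : E → ℝ} (hX : Measurable X)
    (h : ∀ ω, 0 < X ω) : 0 < expect P X := by
  have h0 : ∫⁻ ω, ENNReal.ofReal (-X ω) ∂(P : Measure E) = 0 := by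
    have : ∀ ω, ENNReal.ofReal (-X ω) = 0 := fun ω =>
      ENNReal.ofReal_of_nonpos (neg_nonpos.2 (h ω).le)
    simp [this]
  rw [expect, if_pos (by rw [h0]; exact ENNReal.zero_lt_top), h0]
  simp only [EReal.coe_ennreal_zero, sub_zero, EReal.coe_ennreal_pos]
  rw [lintegral_pos_iff_support hX.ennreal_ofReal]
  have : Function.support (fun ω => ENNReal.ofReal (X ω)) = univ := by
    ext ω
    simp [h ω]
  rw [this]
  simp

end Expectation

/-! ### One trading period with unbounded holdings -/

section OneStep

variable {Ω : Type*} {m m0 : MeasurableSpace Ω} {μ : Measure Ω}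

/-- Fatou's lemma applied to the indicators of the sets A n. -/
theorem lintegral_le_of_forall_setLIntegral_le {A : ℕ → Set Ω} (hA : ∀ n, MeasurableSet (A n))
    (hev : ∀ ω, ∀ᶠ n in atTop, ω ∈ A n) {f : Ω → ENNReal} (hf : Measurable f) {c : ENNReal}
    (h : ∀ n, ∫⁻ ω in A n, f ω ∂μ ≤ c) : ∫⁻ ω, f ω ∂μ ≤ c := by
  have hlim : ∀ ω, liminf (fun n => (A n).indicator f ω) atTop = f ω := fun ω => by
    refine Tendsto.liminf_eq (tendsto_const_nhds.congr' ?_)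
    filter_upwards [hev ω] with n hn
    rw [indicator_of_mem hn]
  calc ∫⁻ ω, f ω ∂μ = ∫⁻ ω, liminf (fun n => (A n).indicator f ω) atTop ∂μ := by simp_rw [hlim]
    _ ≤ liminf (fun n => ∫⁻ ω, (A n).indicator f ω ∂μ) atTop :=
        lintegral_liminf_le fun n => hf.indicator (hA n)
    _ ≤ c := liminf_le_of_frequently_le' (Frequently.of_forall fun n => by
        rw [lintegral_indicator (hA n)]; exact h n)

theorem integrable_bdd_mul {D W : Ω → ℝ} {c : ℝ} (hD : Integrable D μ) (hW : Measurable W)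
    (h0 : ∀ ω, 0 ≤ W ω) (hc : ∀ ω, W ω ≤ c) : Integrable (fun ω => W ω * D ω) μ :=
  hD.bdd_mul (c := c) hW.aestronglyMeasurable (Eventually.of_forall fun ω => by
    rw [Real.norm_eq_abs, abs_of_nonneg (h0 ω)]; exact hc ω)

theorem integral_bdd_mul_nonpos [IsFiniteMeasure μ] (hm : m ≤ m0) {D W : Ω → ℝ} {c : ℝ}
    (hD : Integrable D μ) (hDm : μ[D|m] ≤ᵐ[μ] 0) (hW : Measurable[m] W)
    (h0 : ∀ ω, 0 ≤ W ω) (hc : ∀ ω, W ω ≤ c) : ∫ ω, W ω * D ω ∂μ ≤ 0 := by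
  have hint : Integrable (W * D) μ := integrable_bdd_mul hD (hW.mono hm le_rfl) h0 hc
  have h1 : μ[W * D|m] =ᵐ[μ] W * μ[D|m] :=
    condExp_mul_of_stronglyMeasurable_left hW.stronglyMeasurable hint hD
  calc ∫ ω, W ω * D ω ∂μ = ∫ ω, (μ[W * D|m]) ω ∂μ := (integral_condExp hm).symm
    _ = ∫ ω, (W * μ[D|m]) ω ∂μ := integral_congr_ae h1
    _ ≤ 0 := integral_nonpos_of_ae (hDm.mono fun ω hω =>
        mul_nonpos_of_nonneg_of_nonpos (h0 ω) hω)

variable {ι : Type*} {V : Ω → ℝ} {u D : ι → Ω → ℝ}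

/-- The set on which the current wealth and the holdings are bounded by `n`. -/
def truncSet (V : Ω → ℝ) (u : ι → Ω → ℝ) (n : ℕ) : Set Ω :=
  {ω | |V ω| ≤ n} ∩ ⋂ i, {ω | u i ω ≤ n}

theorem measurableSet_truncSet [Finite ι] (hV : Measurable[m] V) (hu : ∀ i, Measurable[m] (u i)) (n : ℕ) :
    MeasurableSet[m] (truncSet V u n) := by
  refine MeasurableSet.inter ?_ (MeasurableSet.iInter fun i => ?_)
  · exact measurableSet_le (by simpa using hV.norm) measurable_const
  · exact measurableSet_le (hu i) measurable_const

theorem monotone_truncSet : Monotone (truncSet V u) := by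
  intro n n' hn ω hω
  have hc : (n : ℝ) ≤ n' := by exact_mod_cast hn
  refine ⟨le_trans hω.1 hc, mem_iInter.2 fun i => ?_⟩
  exact le_trans (mem_iInter.1 hω.2 i : u i ω ≤ n) hc

variable [Fintype ι]

theorem eventually_mem_truncSet (ω : Ω) : ∀ᶠ n in atTop, ω ∈ truncSet V u n := by
  obtain ⟨N, hN⟩ := exists_nat_ge (|V ω| + ∑ i, |u i ω|)
  refine eventually_atTop.2 ⟨N, fun n hn => monotone_truncSet hn ⟨?_, mem_iInter.2 fun i => ?_⟩⟩
  · have : 0 ≤ ∑ i, |u i ω| := Finset.sum_nonneg fun i _ => abs_nonneg _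
    change |V ω| ≤ N
    linarith
  · have h1 : |u i ω| ≤ ∑ i, |u i ω| :=
      Finset.single_le_sum (f := fun i => |u i ω|) (fun i _ => abs_nonneg _) (Finset.mem_univ i)
    have h2 := abs_nonneg (V ω)
    have h3 := le_abs_self (u i ω)
    change u i ω ≤ N
    linarith

theorem iUnion_truncSet : ⋃ n, truncSet V u n = univ :=
  eq_univ_of_forall fun ω => mem_iUnion.2 (eventually_mem_truncSet ω).exists

/-- The truncation set is known at the beginning of the period, so cutting holdings to it leaves
bounded non-negative `m`-measurable weights, which can be pulled out of the conditional expectation.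
The extra event `B` permits restriction to losses. -/
theorem setIntegral_truncSet_le [IsFiniteMeasure μ] (hm : m ≤ m0) (hV : Measurable[m] V)
    (hu : ∀ i, Measurable[m] (u i)) (hu0 : ∀ i ω, 0 ≤ u i ω) (hD : ∀ i, Integrable (D i) μ)
    (hDm : ∀ i, μ[D i|m] ≤ᵐ[μ] 0) (n : ℕ) {B : Set Ω} (hB : MeasurableSet[m] B) :
    IntegrableOn V (truncSet V u n ∩ B) μ ∧
    IntegrableOn (fun ω => V ω + ∑ i, u i ω * D i ω) (truncSet V u n ∩ B) μ ∧
    ∫ ω in truncSet V u n ∩ B, (V ω + ∑ i, u i ω * D i ω) ∂μ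
      ≤ ∫ ω in truncSet V u n ∩ B, V ω ∂μ := by
  set A := truncSet V u n ∩ B with hA
  have hAm : MeasurableSet[m] A := (measurableSet_truncSet hV hu n).inter hB
  have hAm0 : MeasurableSet A := hm _ hAm
  have hVi : IntegrableOn V A μ := by
    refine Measure.integrableOn_of_bounded (M := n) (measure_ne_top μ A)
      (hV.mono hm le_rfl).aestronglyMeasurable ?_
    exact (ae_restrict_iff' hAm0).2 (Eventually.of_forall fun ω hω => hω.1.1)
  have hW0 : ∀ i ω, 0 ≤ A.indicator (u i) ω := fun i ω => indicator_nonneg (fun ω _ => hu0 i ω) ω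
  have hWn : ∀ i ω, A.indicator (u i) ω ≤ n := fun i ω => by
    refine indicator_le' (fun ω hω => ?_) (fun ω _ => Nat.cast_nonneg n) ω
    exact (mem_iInter.1 hω.1.2 i : u i ω ≤ n)
  have hWm : ∀ i, Measurable[m] (A.indicator (u i)) := fun i => (hu i).indicator hAm
  have e : ∀ i, (fun ω => A.indicator (u i) ω * D i ω) = A.indicator fun ω => u i ω * D i ω :=
    fun i => by
      ext ω
      by_cases h : ω ∈ A <;> simp [h]
  have hi : ∀ i, IntegrableOn (fun ω => u i ω * D i ω) A μ := fun i => by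
    rw [← integrable_indicator_iff hAm0, ← e i]
    exact integrable_bdd_mul (hD i) ((hWm i).mono hm le_rfl) (hW0 i) (hWn i)
  have hle : ∀ i, ∫ ω in A, u i ω * D i ω ∂μ ≤ 0 := fun i => by
    rw [← integral_indicator hAm0, ← e i]
    exact integral_bdd_mul_nonpos hm (hD i) (hDm i) (hWm i) (hW0 i) (hWn i)
  have hsum : IntegrableOn (fun ω => ∑ i, u i ω * D i ω) A μ :=
    integrable_finsetSum _ fun i _ => hi i
  refine ⟨hVi, hVi.add hsum, ?_⟩
  rw [integral_add hVi hsum, integral_finsetSum _ fun i _ => hi i]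
  linarith [Finset.sum_nonpos fun i (_ : i ∈ Finset.univ) => hle i]

/-- Long positions in assets with non-positive conditional returns do not decrease the negative
part of the wealth. -/
theorem lintegral_neg_le [IsFiniteMeasure μ] (hm : m ≤ m0) (hV : Measurable[m] V)
    (hu : ∀ i, Measurable[m] (u i)) (hu0 : ∀ i ω, 0 ≤ u i ω) (hD : ∀ i, Integrable (D i) μ)
    (hDm : ∀ i, μ[D i|m] ≤ᵐ[μ] 0) :
    ∫⁻ ω, ENNReal.ofReal (-V ω) ∂μ
      ≤ ∫⁻ ω, ENNReal.ofReal (-(V ω + ∑ i, u i ω * D i ω)) ∂μ := by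
  have hV0 := hV.mono hm le_rfl
  refine lintegral_le_of_forall_setLIntegral_le
    (fun n => hm _ (measurableSet_truncSet hV hu n)) eventually_mem_truncSet
    hV0.neg.ennreal_ofReal fun n => ?_
  have hB : MeasurableSet[m] {ω | V ω ≤ 0} := measurableSet_le hV measurable_const
  obtain ⟨h1, h2, h3⟩ := setIntegral_truncSet_le hm hV hu hu0 hD hDm n hB
  have hA0 : MeasurableSet (truncSet V u n ∩ {ω | V ω ≤ 0}) :=
    hm _ ((measurableSet_truncSet hV hu n).inter hB)
  -- Only V ≤ 0 contributes, and this event is known beforehand; there the integral of −V is at most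
  -- that of −W, W the new wealth, hence at most that of W⁻.
  calc ∫⁻ ω in truncSet V u n, ENNReal.ofReal (-V ω) ∂μ
      = ∫⁻ ω in truncSet V u n ∩ {ω | V ω ≤ 0}, ENNReal.ofReal (-V ω) ∂μ := by
        rw [inter_comm, ← setLIntegral_indicator (hm _ hB)]
        refine lintegral_congr fun ω => ?_
        by_cases h : V ω ≤ 0
        · rw [indicator_of_mem (show ω ∈ {ω | V ω ≤ 0} from h)]
        · rw [indicator_of_notMem (show ω ∉ {ω | V ω ≤ 0} from h),
            ENNReal.ofReal_of_nonpos (by linarith)]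
    _ = ENNReal.ofReal (∫ ω in truncSet V u n ∩ {ω | V ω ≤ 0}, -V ω ∂μ) := by
        refine (ofReal_integral_eq_lintegral_ofReal h1.neg ?_).symm
        exact (ae_restrict_iff' hA0).2 (Eventually.of_forall fun ω hω => neg_nonneg.2 hω.2)
    _ ≤ ENNReal.ofReal
          (∫ ω in truncSet V u n ∩ {ω | V ω ≤ 0}, -(V ω + ∑ i, u i ω * D i ω) ∂μ) := by
        refine ENNReal.ofReal_le_ofReal ?_
        rw [integral_neg, integral_neg]
        exact neg_le_neg h3
    _ ≤ ∫⁻ ω in truncSet V u n ∩ {ω | V ω ≤ 0},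
          ENNReal.ofReal (-(V ω + ∑ i, u i ω * D i ω)) ∂μ := by
        refine ENNReal.ofReal_le_of_le_toReal ?_
        refine (integral_eq_lintegral_pos_part_sub_lintegral_neg_part h2.neg).trans_le ?_
        exact sub_le_self _ ENNReal.toReal_nonneg
    _ ≤ _ := setLIntegral_le_lintegral _ _

/-- One step of a long strategy in assets with non-positive conditional returns. -/
theorem integrable_and_integral_le [IsFiniteMeasure μ] (hm : m ≤ m0) (hV : Measurable[m] V)
    (hu : ∀ i, Measurable[m] (u i)) (hu0 : ∀ i ω, 0 ≤ u i ω) (hD : ∀ i, Integrable (D i) μ)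
    (hDmeas : ∀ i, Measurable (D i)) (hDm : ∀ i, μ[D i|m] ≤ᵐ[μ] 0) (hVi : Integrable V μ)
    (hneg : ∫⁻ ω, ENNReal.ofReal (-(V ω + ∑ i, u i ω * D i ω)) ∂μ < ⊤) :
    Integrable (fun ω => V ω + ∑ i, u i ω * D i ω) μ ∧
      ∫ ω, (V ω + ∑ i, u i ω * D i ω) ∂μ ≤ ∫ ω, V ω ∂μ := by
  set W : Ω → ℝ := fun ω => V ω + ∑ i, u i ω * D i ω with hW
  have hWm : Measurable W := (hV.mono hm le_rfl).add
    (Finset.measurable_fun_sum _ fun i _ => ((hu i).mono hm le_rfl).mul (hDmeas i))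
  have key : ∀ n, IntegrableOn W (truncSet V u n) μ ∧
      ∫ ω in truncSet V u n, W ω ∂μ ≤ ∫ ω in truncSet V u n, V ω ∂μ := fun n => by
    have := setIntegral_truncSet_le hm hV hu hu0 hD hDm n MeasurableSet.univ
    rw [inter_univ] at this
    exact this.2
  -- On each truncation set ∫ W ≤ ∫ V, so ∫ W⁺ ≤ ∫ |V| + ∫ W⁻ uniformly in n.
  have hpos : ∫⁻ ω, ENNReal.ofReal (W ω) ∂μ
      ≤ ENNReal.ofReal (∫ ω, |V ω| ∂μ) + ∫⁻ ω, ENNReal.ofReal (-W ω) ∂μ := by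
    refine lintegral_le_of_forall_setLIntegral_le
      (fun n => hm _ (measurableSet_truncSet hV hu n)) eventually_mem_truncSet
      hWm.ennreal_ofReal fun n => ?_
    obtain ⟨h1, h2⟩ := key n
    rw [integral_eq_lintegral_pos_part_sub_lintegral_neg_part h1, sub_le_iff_le_add] at h2
    have h3 : ∫ ω in truncSet V u n, V ω ∂μ ≤ ∫ ω, |V ω| ∂μ :=
      (integral_mono hVi.integrableOn hVi.abs.integrableOn fun ω => le_abs_self _).trans
        (setIntegral_le_integral hVi.abs (Eventually.of_forall fun ω => abs_nonneg _))
    calc ∫⁻ ω in truncSet V u n, ENNReal.ofReal (W ω) ∂μ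
        = ENNReal.ofReal (∫⁻ ω in truncSet V u n, ENNReal.ofReal (W ω) ∂μ).toReal :=
          (ENNReal.ofReal_toReal h1.lintegral_lt_top.ne).symm
      _ ≤ ENNReal.ofReal (∫ ω, |V ω| ∂μ
            + (∫⁻ ω in truncSet V u n, ENNReal.ofReal (-W ω) ∂μ).toReal) :=
          ENNReal.ofReal_le_ofReal (by linarith)
      _ ≤ ENNReal.ofReal (∫ ω, |V ω| ∂μ)
            + ENNReal.ofReal (∫⁻ ω in truncSet V u n, ENNReal.ofReal (-W ω) ∂μ).toReal :=
          ENNReal.ofReal_add_le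
      _ ≤ _ := by
          gcongr
          exact ENNReal.ofReal_toReal_le.trans (setLIntegral_le_lintegral _ _)
  have hWi : Integrable W μ := by
    refine ⟨hWm.aestronglyMeasurable, ?_⟩
    have e : ∀ ω, ‖W ω‖ₑ = ENNReal.ofReal (W ω) + ENNReal.ofReal (-W ω) := fun ω => by
      rw [Real.enorm_eq_ofReal_abs]
      rcases le_total 0 (W ω) with h | h
      · rw [abs_of_nonneg h, ENNReal.ofReal_of_nonpos (neg_nonpos.2 h), add_zero]
      · rw [abs_of_nonpos h, ENNReal.ofReal_of_nonpos h, zero_add]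
    rw [hasFiniteIntegral_iff_enorm]
    simp_rw [e]
    rw [lintegral_add_left hWm.ennreal_ofReal]
    exact ENNReal.add_lt_top.2
      ⟨hpos.trans_lt (ENNReal.add_lt_top.2 ⟨ENNReal.ofReal_lt_top, hneg⟩), hneg⟩
  refine ⟨hWi, ?_⟩
  have hlim : ∀ f : Ω → ℝ, Integrable f μ →
      Tendsto (fun n => ∫ ω in truncSet V u n, f ω ∂μ) atTop (𝓝 (∫ ω, f ω ∂μ)) := fun f hf => by
    have := tendsto_setIntegral_of_monotone (μ := μ) (f := f)
      (fun n => hm _ (measurableSet_truncSet hV hu n)) monotone_truncSet hf.integrableOn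
    rwa [iUnion_truncSet, setIntegral_univ] at this
  exact le_of_tendsto_of_tendsto' (hlim W hWi) (hlim V hVi) fun n => (key n).2

end OneStep

/-! ### Comparing measures through continuous test functions -/

section MeasureComparison

variable {X : Type*} [TopologicalSpace X] [MeasurableSpace X] [BorelSpace X]

/-- Finite measures are ordered as soon as they are ordered on bounded continuous functions. -/
theorem measure_le_of_forall_lintegral_le [HasOuterApproxClosed X] {ν₁ ν₂ : Measure X}
    [IsFiniteMeasure ν₁] [IsFiniteMeasure ν₂] [ν₁.WeaklyRegular]
    (h : ∀ f : BoundedContinuousFunction X NNReal, ∫⁻ x, f x ∂ν₁ ≤ ∫⁻ x, f x ∂ν₂)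
    {A : Set X} (hA : MeasurableSet A) : ν₁ A ≤ ν₂ A := by
  rw [hA.measure_eq_iSup_isClosed_of_ne_top (measure_ne_top ν₁ A)]
  refine iSup_le fun F => iSup_le fun hFA => iSup_le fun hF => ?_
  refine le_trans ?_ (measure_mono hFA)
  exact le_of_tendsto_of_tendsto' (HasOuterApproxClosed.tendsto_lintegral_apprSeq hF ν₁)
    (HasOuterApproxClosed.tendsto_lintegral_apprSeq hF ν₂) fun n => h _

end MeasureComparison

/-! ### Prices, growth function and elementary strategies -/

section Model

variable {J T : ℕ} {Ω : Set (Fin T → Fin (J + 1) → ℝ)}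

/-- Standing assumptions on the scenarios and the initial prices. -/
structure IsPriceModel (Ω : Set (Fin T → Fin (J + 1) → ℝ)) (a b : Fin T → ℝ) (s₀ : Fin J → ℝ) :
    Prop where
  closed : IsClosed Ω
  pos : ∀ k, 0 < a k
  bounds : ∀ ω ∈ Ω, ∀ k, ω k 0 ∈ Icc (a k) (b k) ∧ ∀ j : Fin J, 0 ≤ ω k j.succ
  init : ∀ j, 0 ≤ s₀ j

theorem continuous_price (s₀ : Fin J → ℝ) (t : Fin (T + 1)) (j : Fin (J + 1)) :
    Continuous (price s₀ t j : Ω → ℝ) := by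
  refine Fin.cases ?_ (fun k => ?_) t
  · exact continuous_const
  · exact (continuous_apply j).comp ((continuous_apply k).comp continuous_subtype_val)

theorem discPrice_zero (s₀ : Fin J → ℝ) (j : Fin J) (ω : Ω) : discPrice s₀ 0 j ω = s₀ j := by
  simp [discPrice, price]

namespace IsPriceModel

variable {a b : Fin T → ℝ} {s₀ : Fin J → ℝ} (M : IsPriceModel Ω a b s₀)
include M

theorem price_zero_pos (t : Fin (T + 1)) (ω : Ω) : 0 < price s₀ t 0 ω := by
  refine Fin.cases ?_ (fun k => ?_) t
  · exact one_pos
  · exact (M.pos k).trans_le (M.bounds ω ω.2 k).1.1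

theorem price_nonneg (t : Fin (T + 1)) (j : Fin J) (ω : Ω) : 0 ≤ price s₀ t j.succ ω := by
  refine Fin.cases ?_ (fun k => ?_) t
  · simpa [price] using M.init j
  · exact (M.bounds ω ω.2 k).2 j

theorem discPrice_nonneg (t : Fin (T + 1)) (j : Fin J) (ω : Ω) : 0 ≤ discPrice s₀ t j ω :=
  div_nonneg (M.price_nonneg t j ω) (M.price_zero_pos t ω).le

theorem continuous_discPrice (t : Fin (T + 1)) (j : Fin J) :
    Continuous (discPrice s₀ t j : Ω → ℝ) :=
  (continuous_price s₀ t j.succ).div (continuous_price s₀ t 0) fun ω => (M.price_zero_pos t ω).ne'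

theorem one_le_growth (p : ℝ) (ω : Ω) : 1 ≤ growth s₀ p ω :=
  le_add_of_nonneg_right (Finset.sum_nonneg fun _ _ => Finset.sum_nonneg fun _ _ =>
    Real.rpow_nonneg (M.discPrice_nonneg _ _ ω) p)

theorem continuous_growth {p : ℝ} (hp : 1 ≤ p) : Continuous (growth s₀ p : Ω → ℝ) :=
  continuous_const.add (continuous_finsetSum _ fun _ _ => continuous_finsetSum _ fun _ _ =>
    (M.continuous_discPrice _ _).rpow_const fun _ => Or.inr (zero_le_one.trans hp))

theorem discPrice_succ_le_growth {p : ℝ} (hp : 1 ≤ p) (k : Fin T) (j : Fin J) (ω : Ω) :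
    discPrice s₀ k.succ j ω ≤ growth s₀ p ω := by
  have hpow : ∀ k j, 0 ≤ discPrice s₀ (Fin.succ k) j ω ^ p := fun k j =>
    Real.rpow_nonneg (M.discPrice_nonneg _ _ ω) p
  have h1 : discPrice s₀ k.succ j ω ^ p ≤ ∑ j, discPrice s₀ k.succ j ω ^ p :=
    Finset.single_le_sum (f := fun j => discPrice s₀ k.succ j ω ^ p) (fun j _ => hpow k j)
      (Finset.mem_univ j)
  have h2 : ∑ j, discPrice s₀ k.succ j ω ^ p ≤ ∑ k : Fin T, ∑ j, discPrice s₀ k.succ j ω ^ p :=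
    Finset.single_le_sum (f := fun k : Fin T => ∑ j, discPrice s₀ k.succ j ω ^ p)
      (fun k _ => Finset.sum_nonneg fun j _ => hpow k j) (Finset.mem_univ k)
  rcases le_total (discPrice s₀ k.succ j ω) 1 with h | h
  · exact h.trans (M.one_le_growth p ω)
  · have := Real.self_le_rpow_of_one_le h hp
    unfold growth
    linarith

theorem discPrice_mem {p : ℝ} (hp : 1 ≤ p) (t : Fin (T + 1)) (j : Fin J) :
    (discPrice s₀ t j : Ω → ℝ) ∈ dominatedBy (growth s₀ p : Ω → ℝ) := by
  refine Fin.cases ?_ (fun k => ?_) t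
  · refine ⟨s₀ j, fun ω => ?_⟩
    rw [abs_of_nonneg (M.discPrice_nonneg _ _ ω), discPrice_zero]
    exact le_mul_of_one_le_right (M.init j) (M.one_le_growth p ω)
  · refine ⟨1, fun ω => ?_⟩
    rw [abs_of_nonneg (M.discPrice_nonneg _ _ ω), one_mul]
    exact M.discPrice_succ_le_growth hp k j ω

/-- Bounded growth bounds discounted prices, and the bounded numeraire turns this into a bound on
nominal prices. The factor max(R, 1) lets one box also contain the numeraire. -/
theorem isCompact_growth_le {p : ℝ} (hp : 1 ≤ p) (R : ℝ) :
    IsCompact {ω : Ω | growth s₀ p ω ≤ R} := by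
  have hbox : IsCompact ((↑) ⁻¹' Icc (0 : Fin T → Fin (J + 1) → ℝ) (fun k _ => max R 1 * b k) :
      Set Ω) := M.closed.isClosedEmbedding_subtypeVal.isCompact_preimage isCompact_Icc
  refine hbox.of_isClosed_subset (isClosed_le (M.continuous_growth hp) continuous_const) ?_
  intro ω hω
  have hω : growth s₀ p ω ≤ R := hω
  have hk : ∀ k j, 0 ≤ (ω : Fin T → Fin (J + 1) → ℝ) k j ∧
      (ω : Fin T → Fin (J + 1) → ℝ) k j ≤ max R 1 * b k := by
    intro k j
    obtain ⟨⟨h1, h2⟩, h3⟩ := M.bounds ω ω.2 k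
    have hb : 0 ≤ b k := (M.pos k).le.trans (h1.trans h2)
    refine Fin.cases ?_ (fun j => ?_) j
    · exact ⟨(M.pos k).le.trans h1, h2.trans (le_mul_of_one_le_left hb (le_max_right _ _))⟩
    · refine ⟨h3 j, ?_⟩
      have h4 := (M.discPrice_succ_le_growth hp k j ω).trans (hω.trans (le_max_left R 1))
      have h5 : price s₀ k.succ j.succ ω ≤ max R 1 * price s₀ k.succ 0 ω :=
        (div_le_iff₀ (M.price_zero_pos k.succ ω)).1 h4
      exact h5.trans (mul_le_mul_of_nonneg_left h2 (zero_le_one.trans (le_max_right _ _)))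
  exact ⟨fun k j => (hk k j).1, fun k j => (hk k j).2⟩

theorem locallyCompactSpace : LocallyCompactSpace Ω :=
  M.closed.isClosedEmbedding_subtypeVal.locallyCompactSpace

end IsPriceModel

theorem measurable_discPrice (s₀ : Fin J → ℝ) {s t : Fin (T + 1)} (hst : s ≤ t) (j : Fin J) :
    Measurable[priceFiltration Ω s₀ t] (discPrice s₀ s j : Ω → ℝ) := by
  have h : Measurable[priceFiltration Ω s₀ t] (fun (ω : Ω) (j : Fin (J + 1)) => price s₀ s j ω) :=
    ((comap_measurable _).mono (le_iSup₂_of_le s hst le_rfl) le_rfl)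
  exact ((measurable_pi_apply j.succ).comp h).div ((measurable_pi_apply 0).comp h)

theorem measurable_discPrice' (s₀ : Fin J → ℝ) (t : Fin (T + 1)) (j : Fin J) :
    Measurable (discPrice s₀ t j : Ω → ℝ) :=
  (measurable_discPrice s₀ le_rfl j).mono ((priceFiltration Ω s₀).le t) le_rfl

theorem IsLongStrategy.measurable {s₀ : Fin J → ℝ} {ϑ : Fin T → Fin J → Ω → ℝ}
    (h : IsLongStrategy s₀ ϑ) (k : Fin T) (j : Fin J) : Measurable (ϑ k j) :=
  (h k j).1.mono ((priceFiltration Ω s₀).le _) le_rfl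

theorem measurable_dynGain {s₀ : Fin J → ℝ} {ϑ : Fin T → Fin J → Ω → ℝ}
    (h : IsLongStrategy s₀ ϑ) : Measurable (dynGain s₀ ϑ) :=
  Finset.measurable_fun_sum _ fun k _ => Finset.measurable_fun_sum _ fun j _ =>
    (h.measurable k j).mul ((measurable_discPrice' s₀ _ j).sub (measurable_discPrice' s₀ _ j))

/-- The strategy that holds `u` units of asset `j` from time `k` to `k + 1`. -/
def singleStrategy (k : Fin T) (j : Fin J) (u : Ω → ℝ) : Fin T → Fin J → Ω → ℝ :=
  fun k' j' ω => if k' = k then if j' = j then u ω else 0 else 0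

theorem isLongStrategy_single {s₀ : Fin J → ℝ} {k : Fin T} (j : Fin J) {u : Ω → ℝ}
    (hu : Measurable[priceFiltration Ω s₀ k.castSucc] u) (hu0 : ∀ ω, 0 ≤ u ω) :
    IsLongStrategy s₀ (singleStrategy k j u) := by
  intro k' j'
  unfold singleStrategy
  by_cases hk : k' = k
  · subst hk
    by_cases hj : j' = j
    · subst hj
      simp only [if_true]
      exact ⟨hu, hu0⟩
    · simp [hj]
  · simp [hk]

theorem dynGain_single (s₀ : Fin J → ℝ) (k : Fin T) (j : Fin J) (u : Ω → ℝ) (ω : Ω) :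
    dynGain s₀ (singleStrategy k j u) ω
      = u ω * (discPrice s₀ k.succ j ω - discPrice s₀ k.castSucc j ω) := by
  unfold dynGain singleStrategy
  rw [Finset.sum_eq_single k (fun k' _ hk => by simp [hk]) (by simp),
    Finset.sum_eq_single j (fun j' _ hj => by simp [hj]) (by simp)]
  simp

/-! ### Supermartingale measures and long trading -/

section Martingale

variable {a b : Fin T → ℝ} {s₀ : Fin J → ℝ}

/-- Accumulated gains of a dynamic strategy up to time `t`. -/
def partialGain (s₀ : Fin J → ℝ) (ϑ : Fin T → Fin J → Ω → ℝ) (t : Fin (T + 1)) (ω : Ω) : ℝ :=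
  ∑ k : Fin T, if k.castSucc < t then ∑ j : Fin J,
    ϑ k j ω * (discPrice s₀ k.succ j ω - discPrice s₀ k.castSucc j ω) else 0

theorem partialGain_zero (ϑ : Fin T → Fin J → Ω → ℝ) (ω : Ω) : partialGain s₀ ϑ 0 ω = 0 :=
  Finset.sum_eq_zero fun _ _ => if_neg (Fin.not_lt_zero _)

theorem partialGain_succ (ϑ : Fin T → Fin J → Ω → ℝ) (k : Fin T) (ω : Ω) :
    partialGain s₀ ϑ k.succ ω = partialGain s₀ ϑ k.castSucc ω
      + ∑ j : Fin J, ϑ k j ω * (discPrice s₀ k.succ j ω - discPrice s₀ k.castSucc j ω) := by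
  unfold partialGain
  conv_rhs => rw [← Finset.sum_ite_eq' Finset.univ k (fun k => ∑ j : Fin J,
    ϑ k j ω * (discPrice s₀ k.succ j ω - discPrice s₀ k.castSucc j ω)) |>.trans
      (if_pos (Finset.mem_univ k))]
  rw [← Finset.sum_add_distrib]
  refine Finset.sum_congr rfl fun k' _ => ?_
  rcases lt_trichotomy k' k with h | h | h
  · rw [if_pos (by simpa [Fin.lt_def] using Nat.lt_succ_of_lt h), if_pos (by simpa using h),
      if_neg h.ne, add_zero]
  · subst h
    simp
  · rw [if_neg (by simp only [Fin.lt_def, Fin.val_castSucc, Fin.val_succ] at h ⊢; omega),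
      if_neg (by simpa using h.le), if_neg h.ne', add_zero]

theorem partialGain_last (ϑ : Fin T → Fin J → Ω → ℝ) (ω : Ω) :
    partialGain s₀ ϑ (Fin.last T) ω = dynGain s₀ ϑ ω :=
  Finset.sum_congr rfl fun k _ => if_pos (Fin.castSucc_lt_last k)

theorem measurable_partialGain {ϑ : Fin T → Fin J → Ω → ℝ} (h : IsLongStrategy s₀ ϑ)
    (t : Fin (T + 1)) : Measurable[priceFiltration Ω s₀ t] (partialGain s₀ ϑ t) := by
  refine Finset.measurable_fun_sum _ fun k _ => ?_
  by_cases hk : k.castSucc < t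
  · simp only [hk, if_true]
    refine Finset.measurable_fun_sum _ fun j _ => Measurable.mul ?_ (Measurable.sub ?_ ?_)
    · exact (h k j).1.mono ((priceFiltration Ω s₀).mono hk.le) le_rfl
    · exact measurable_discPrice s₀ (Fin.castSucc_lt_iff_succ_le.1 hk) j
    · exact measurable_discPrice s₀ hk.le j
  · simp only [hk, if_false]
    exact measurable_const

/-- Long trading in supermartingales has non-positive expected gains. -/
theorem IsSupermartingaleMeasure.integral_dynGain_nonpos {P : ProbabilityMeasure Ω}
    (hP : IsSupermartingaleMeasure s₀ P) {ϑ : Fin T → Fin J → Ω → ℝ} (h : IsLongStrategy s₀ ϑ)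
    (hneg : ∫⁻ ω, ENNReal.ofReal (-dynGain s₀ ϑ ω) ∂(P : Measure Ω) < ⊤) :
    Integrable (dynGain s₀ ϑ) (P : Measure Ω) ∧ ∫ ω, dynGain s₀ ϑ ω ∂(P : Measure Ω) ≤ 0 := by
  have main : ∀ t : Fin (T + 1),
      ∫⁻ ω, ENNReal.ofReal (-partialGain s₀ ϑ t ω) ∂(P : Measure Ω) < ⊤ →
      Integrable (partialGain s₀ ϑ t) (P : Measure Ω) ∧
        ∫ ω, partialGain s₀ ϑ t ω ∂(P : Measure Ω) ≤ 0 := by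
    intro t
    induction t using Fin.induction with
    | zero =>
      intro _
      have e : partialGain s₀ ϑ 0 = fun _ : Ω => 0 := funext (partialGain_zero ϑ)
      rw [e]
      simp
    | succ k ih =>
      intro hk
      have e : partialGain s₀ ϑ k.succ = _ := funext (partialGain_succ (s₀ := s₀) ϑ k)
      rw [e] at hk ⊢
      have hm := (priceFiltration Ω s₀).le k.castSucc
      have hV := measurable_partialGain h k.castSucc
      have hD : ∀ j, Integrable (fun ω => discPrice s₀ k.succ j ω - discPrice s₀ k.castSucc j ω)
          (P : Measure Ω) := fun j => ((hP j).2.2 _).sub ((hP j).2.2 _)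
      have hDm : ∀ j, (P : Measure Ω)[fun ω => discPrice s₀ k.succ j ω
          - discPrice s₀ k.castSucc j ω|priceFiltration Ω s₀ k.castSucc] ≤ᵐ[(P : Measure Ω)] 0 := by
        intro j
        have h1 := condExp_sub ((hP j).2.2 k.succ) ((hP j).2.2 k.castSucc)
          (priceFiltration Ω s₀ k.castSucc)
        have h2 := condExp_of_stronglyMeasurable hm
          (measurable_discPrice s₀ le_rfl j).stronglyMeasurable ((hP j).2.2 k.castSucc)
        filter_upwards [h1, (hP j).2.1 k.castSucc k.succ Fin.castSucc_lt_succ.le] with ω w1 w2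
        rw [h2, Pi.sub_apply] at w1
        exact w1.trans_le (sub_nonpos.2 w2)
      -- Finiteness of the negative part passes back to time k, which makes the induction hypothesis
      -- available.
      have h1 := lintegral_neg_le hm hV (fun j => (h k j).1) (fun j => (h k j).2) hD hDm
      obtain ⟨h2, h3⟩ := ih (h1.trans_lt hk)
      obtain ⟨h4, h5⟩ := integrable_and_integral_le hm hV (fun j => (h k j).1)
        (fun j => (h k j).2) hD
        (fun j => (measurable_discPrice' s₀ _ j).sub (measurable_discPrice' s₀ _ j)) hDm h2 hk
      exact ⟨h4, h5.trans h3⟩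
  have e : partialGain s₀ ϑ (Fin.last T) = dynGain s₀ ϑ := funext (partialGain_last ϑ)
  have := main (Fin.last T)
  rw [e] at this
  exact this hneg

/-- If the total has non-integrable losses, the left side is −∞. Otherwise the losses of the dynamic
part are at most those of the total plus Y⁺, hence integrable. -/
theorem IsSupermartingaleMeasure.expect_le {P : ProbabilityMeasure Ω}
    (hP : IsSupermartingaleMeasure s₀ P) {ϑ : Fin T → Fin J → Ω → ℝ} (h : IsLongStrategy s₀ ϑ)
    {Y : Ω → ℝ} (hYm : Measurable Y) (hY : Integrable Y (P : Measure Ω)) :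
    expect P (fun ω => dynGain s₀ ϑ ω + Y ω) ≤ expect P Y := by
  by_cases hneg : ∫⁻ ω, ENNReal.ofReal (-(dynGain s₀ ϑ ω + Y ω)) ∂(P : Measure Ω) < ⊤
  · have hdyn : ∫⁻ ω, ENNReal.ofReal (-dynGain s₀ ϑ ω) ∂(P : Measure Ω) < ⊤ := by
      calc ∫⁻ ω, ENNReal.ofReal (-dynGain s₀ ϑ ω) ∂(P : Measure Ω)
          ≤ ∫⁻ ω, (ENNReal.ofReal (-(dynGain s₀ ϑ ω + Y ω)) + ENNReal.ofReal (Y ω))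
              ∂(P : Measure Ω) := by
            refine lintegral_mono fun ω => ?_
            refine le_trans (ENNReal.ofReal_le_ofReal (le_of_eq ?_)) ENNReal.ofReal_add_le
            ring
        _ = _ := lintegral_add_right _ hYm.ennreal_ofReal
        _ < ⊤ := ENNReal.add_lt_top.2 ⟨hneg, hY.lintegral_lt_top⟩
    obtain ⟨h1, h2⟩ := hP.integral_dynGain_nonpos h hdyn
    have h3 : Integrable (fun ω => dynGain s₀ ϑ ω + Y ω) (P : Measure Ω) := h1.add hY
    rw [expect_of_integrable P h3, expect_of_integrable P hY, EReal.coe_le_coe_iff]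
    have : ∫ ω, (dynGain s₀ ϑ ω + Y ω) ∂(P : Measure Ω) = _ := integral_add h1 hY
    exact this.trans_le (by linarith)
  · rw [expect_eq_bot hneg]
    exact bot_le

/-- A measure under which continuous long dynamic trading has bounded expected gains is a
supermartingale measure. -/
theorem IsPriceModel.isSupermartingaleMeasure (M : IsPriceModel Ω a b s₀) {p : ℝ} (hp : 1 ≤ p)
    {P : ProbabilityMeasure Ω} (hZ : Integrable (growth s₀ p) (P : Measure Ω)) {C : ℝ}
    (hC : ∀ ϑ : Fin T → Fin J → Ω → ℝ, IsLongStrategy s₀ ϑ → Continuous (dynGain s₀ ϑ) →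
      dynGain s₀ ϑ ∈ dominatedBy (growth s₀ p : Ω → ℝ) →
      ∫ ω, dynGain s₀ ϑ ω ∂(P : Measure Ω) ≤ C) :
    IsSupermartingaleMeasure s₀ P := by
  intro j
  have hint : ∀ t, Integrable (discPrice s₀ t j) (P : Measure Ω) := fun t => by
    obtain ⟨c, hc⟩ := M.discPrice_mem hp t j
    exact (hZ.const_mul c).mono' (measurable_discPrice' s₀ t j).aestronglyMeasurable
      (Eventually.of_forall hc)
  have hstep : ∀ (k : Fin T) (A : Set Ω), MeasurableSet[priceFiltration Ω s₀ k.castSucc] A →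
      ∫ ω in A, discPrice s₀ k.succ j ω ∂(P : Measure Ω)
        ≤ ∫ ω in A, discPrice s₀ k.castSucc j ω ∂(P : Measure Ω) := by
    intro k A hA
    set π : Ω → (Iic k.castSucc → Fin (J + 1) → ℝ) := fun ω s i => price s₀ s i ω with hπ
    have hF : (priceFiltration Ω s₀ k.castSucc : MeasurableSpace Ω)
        = MeasurableSpace.comap π inferInstance :=
      Filtration.natural_eq_comap _ _ _
    have hπc : Continuous π := continuous_pi fun s => continuous_pi fun i =>
      continuous_price s₀ s.1 i
    have hπm : Measurable π := hπc.measurable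
    -- Weighting P by the price at time t and projecting to the past up to k turns the
    -- supermartingale inequality on past events into an ordering of two finite measures.
    let ν : Fin (T + 1) → Measure (Iic k.castSucc → Fin (J + 1) → ℝ) := fun t =>
      ((P : Measure Ω).withDensity fun ω => ENNReal.ofReal (discPrice s₀ t j ω)).map π
    have hfin : ∀ t, IsFiniteMeasure (ν t) := fun t => by
      have := isFiniteMeasure_withDensity (μ := (P : Measure Ω))
        (f := fun ω => ENNReal.ofReal (discPrice s₀ t j ω)) (hint t).lintegral_lt_top.ne
      infer_instance
    have hdens : ∀ t, Measurable fun ω : Ω => ENNReal.ofReal (discPrice s₀ t j ω) := fun t =>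
      (measurable_discPrice' s₀ t j).ennreal_ofReal
    have hf : ∀ f : BoundedContinuousFunction (Iic k.castSucc → Fin (J + 1) → ℝ) NNReal,
        ∫⁻ x, f x ∂(ν k.succ) ≤ ∫⁻ x, f x ∂(ν k.castSucc) := by
      intro f
      have hfm : Measurable fun x => (f x : ENNReal) :=
        f.continuous.measurable.coe_nnreal_ennreal
      have hfc : Continuous fun ω => (f (π ω) : ℝ) :=
        NNReal.continuous_coe.comp (f.continuous.comp hπc)
      have hf0 : ∀ ω, 0 ≤ (f (π ω) : ℝ) := fun ω => NNReal.coe_nonneg _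
      obtain ⟨c, hc⟩ : ∃ c : ℝ, ∀ ω, (f (π ω) : ℝ) ≤ c :=
        ⟨nndist f 0, fun ω => NNReal.coe_le_coe.2 (BoundedContinuousFunction.NNReal.upper_bound f (π ω))⟩
      have hI : ∀ t, Integrable (fun ω => (f (π ω) : ℝ) * discPrice s₀ t j ω) (P : Measure Ω) :=
        fun t => integrable_bdd_mul (hint t) hfc.measurable hf0 hc
      have hval : ∀ t, ∫⁻ x, f x ∂(ν t)
          = ENNReal.ofReal (∫ ω, (f (π ω) : ℝ) * discPrice s₀ t j ω ∂(P : Measure Ω)) := by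
        intro t
        have hfπ : Measurable fun ω => (f (π ω) : ENNReal) := hfm.comp hπm
        rw [lintegral_map hfm hπm, lintegral_withDensity_eq_lintegral_mul _ (hdens t) hfπ,
          ofReal_integral_eq_lintegral_ofReal (hI t)
            (Eventually.of_forall fun ω => mul_nonneg (hf0 ω) (M.discPrice_nonneg t j ω))]
        refine lintegral_congr fun ω => ?_
        rw [ENNReal.ofReal_mul (hf0 ω), ENNReal.ofReal_coe_nnreal, mul_comm]
        rfl
      rw [hval, hval]
      refine ENNReal.ofReal_le_ofReal ?_
      -- Holding n f(π) shares is admissible for every n, so a bound C independent of n forces the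
      -- difference of integrals to be non-positive.
      have hn : ∀ n : ℕ, n * (∫ ω, (f (π ω) : ℝ) * discPrice s₀ k.succ j ω ∂(P : Measure Ω)
          - ∫ ω, (f (π ω) : ℝ) * discPrice s₀ k.castSucc j ω ∂(P : Measure Ω)) ≤ C := by
        intro n
        have hlong := isLongStrategy_single (s₀ := s₀) (k := k) j
          (u := fun ω => n * (f (π ω) : ℝ)) (by
            rw [hF]
            exact (measurable_const.mul (NNReal.continuous_coe.comp f.continuous).measurable).comp
              (comap_measurable π)) (fun ω => mul_nonneg (Nat.cast_nonneg n) (hf0 ω))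
        have e : dynGain s₀ (singleStrategy k j fun ω => n * (f (π ω) : ℝ)) = fun ω : Ω =>
            n * ((f (π ω) : ℝ) * discPrice s₀ k.succ j ω
              - (f (π ω) : ℝ) * discPrice s₀ k.castSucc j ω) := by
          ext ω
          rw [dynGain_single]
          ring
        have hdom : ∀ t, (fun ω => (f (π ω) : ℝ) * discPrice s₀ t j ω)
            ∈ dominatedBy (growth s₀ p : Ω → ℝ) := fun t => by
          obtain ⟨d, hd⟩ := M.discPrice_mem hp t j
          refine ⟨c * d, fun ω => ?_⟩
          rw [abs_mul, abs_of_nonneg (hf0 ω), mul_assoc]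
          exact mul_le_mul (hc ω) (hd ω) (abs_nonneg _) ((hf0 ω).trans (hc ω))
        have := hC _ hlong
          (by
            rw [e]
            exact continuous_const.mul ((hfc.mul (M.continuous_discPrice _ j)).sub
              (hfc.mul (M.continuous_discPrice _ j))))
          (by
            rw [e]
            exact Submodule.smul_mem _ (n : ℝ) (Submodule.sub_mem _ (hdom _) (hdom _)))
        rw [e, integral_const_mul, integral_sub (hI _) (hI _)] at this
        exact this
      by_contra hlt
      have hpos := sub_pos.2 (not_le.1 hlt)
      obtain ⟨n, hn'⟩ := exists_nat_gt (C / _)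
      rw [div_lt_iff₀ hpos] at hn'
      exact absurd (hn n) (not_le.2 hn')
    rw [hF] at hA
    obtain ⟨B, hB, rfl⟩ := hA
    have hle := measure_le_of_forall_lintegral_le hf hB
    have hm : MeasurableSet (π ⁻¹' B) := hπm hB
    have hval : ∀ t, ν t B
        = ENNReal.ofReal (∫ ω in π ⁻¹' B, discPrice s₀ t j ω ∂(P : Measure Ω)) := fun t => by
      rw [Measure.map_apply hπm hB, withDensity_apply _ hm,
        ofReal_integral_eq_lintegral_ofReal (hint t).integrableOn
          (Eventually.of_forall fun ω => M.discPrice_nonneg t j ω)]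
    rw [hval, hval] at hle
    exact (ENNReal.ofReal_le_ofReal_iff
      (integral_nonneg fun ω => M.discPrice_nonneg _ j ω)).1 hle
  have hchain : ∀ i t : Fin (T + 1), i ≤ t → ∀ A : Set Ω, MeasurableSet[priceFiltration Ω s₀ i] A →
      ∫ ω in A, discPrice s₀ t j ω ∂(P : Measure Ω)
        ≤ ∫ ω in A, discPrice s₀ i j ω ∂(P : Measure Ω) := by
    intro i t
    induction t using Fin.induction with
    | zero =>
      intro hi A _
      rw [Fin.le_zero_iff.1 hi]
    | succ k ih =>
      intro hi A hA
      rcases hi.eq_or_lt with rfl | hlt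
      · exact le_rfl
      · have hik : i ≤ k.castSucc := Fin.le_castSucc_iff.2 hlt
        exact (hstep k A ((priceFiltration Ω s₀).mono hik _ hA)).trans (ih hik A hA)
  have hsub : Submartingale (fun t (ω : Ω) => -discPrice s₀ t j ω) (priceFiltration Ω s₀)
      (P : Measure Ω) := by
    refine submartingale_of_setIntegral_le
      (fun t => (measurable_discPrice s₀ le_rfl j).neg.stronglyMeasurable)
      (fun t => (hint t).neg) fun i t hit A hA => ?_
    rw [integral_neg, integral_neg]
    exact neg_le_neg (hchain i t hit A hA)
  have := hsub.neg
  have e : (-fun t (ω : Ω) => -discPrice s₀ t j ω) = fun t (ω : Ω) => discPrice s₀ t j ω := by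
    ext t ω
    simp
  rwa [e] at this

end Martingale

end Model

/-! ### Extended-valued superhedging and weak duality -/

section Bounded

variable {E : Type*} [MeasurableSpace E] {Z : E → ℝ}

theorem mem_dominatedBy_of_mem_boundedBy (h1 : ∀ ω, 1 ≤ Z ω) {X : E → ℝ}
    (hX : X ∈ boundedBy Z) : X ∈ dominatedBy Z := by
  obtain ⟨-, C, hC⟩ := hX
  refine ⟨C, fun ω => ?_⟩
  have hZ : 0 < Z ω := one_pos.trans_le (h1 ω)
  have := hC ω
  rwa [abs_div, abs_of_pos hZ, div_le_iff₀ hZ] at this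

theorem integrable_of_mem_dominatedBy {μ : Measure E} (hZ : Integrable Z μ) {X : E → ℝ}
    (hX : X ∈ dominatedBy Z) (hm : Measurable X) : Integrable X μ := by
  obtain ⟨C, hC⟩ := hX
  exact (hZ.const_mul C).mono' hm.aestronglyMeasurable (Eventually.of_forall hC)

/-- Gains and claim being measurable, so is the surplus; membership in `posCone` reduces to a
pointwise inequality. -/
theorem superhedge_eq_sInf {G : Set (E → ℝ)} (hG : ∀ g ∈ G, Measurable g) {X : E → ℝ}
    (hX : Measurable X) :
    superhedge (posCone E) G X = sInf ((fun m : ℝ => (m : EReal)) '' hedgeCapital G X) := by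
  unfold superhedge
  congr 2
  ext m
  constructor
  · intro hm
    obtain ⟨y, hy, g, hg, e⟩ := Set.mem_sub.1 hm
    refine ⟨g, hg, fun ω => ?_⟩
    have h1 := congrFun e ω
    have h2 := hy.2 ω
    simp only [Pi.sub_apply] at h1
    linarith
  · rintro ⟨g, hg, h⟩
    refine Set.mem_sub.2 ⟨fun ω => m - X ω + g ω, ⟨?_, fun ω => ?_⟩, g, hg, ?_⟩
    · exact (measurable_const.sub hX).add (hG g hg)
    · dsimp only
      linarith [h ω]
    · ext ω
      simp

theorem IsHedgingSet.superhedge_eq {G : Set (E → ℝ)} (hG : IsHedgingSet Z G)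
    (hm : ∀ g ∈ G, Measurable g) {X : E → ℝ} (hX : Measurable X) (hXZ : X ∈ dominatedBy Z) :
    superhedge (posCone E) G X = ((hedgeCost G X : ℝ) : EReal) := by
  rw [superhedge_eq_sInf hm hX]
  refine IsGLB.sInf_eq ⟨?_, fun x hx => ?_⟩
  · rintro _ ⟨m, hm, rfl⟩
    exact EReal.coe_le_coe_iff.2 (hG.cost_le hXZ hm)
  · induction x with
    | bot => exact bot_le
    | coe r =>
      refine EReal.coe_le_coe_iff.2 (le_csInf (hG.nonempty hXZ) fun m hm => ?_)
      exact EReal.coe_le_coe_iff.1 (hx (mem_image_of_mem _ hm))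
    | top =>
      obtain ⟨m, hm⟩ := hG.nonempty hXZ
      exact absurd (hx (mem_image_of_mem _ hm)) (not_le.2 (EReal.coe_lt_top m))

/-- Weak duality. -/
theorem expect_sub_penalty_le {G : Set (E → ℝ)} (hm : ∀ g ∈ G, Measurable g)
    {P : ProbabilityMeasure E} (hP : Integrable Z (P : Measure E)) {X : E → ℝ}
    (hX : Measurable X) (hXZ : X ∈ dominatedBy Z) :
    expect P X - penalty G P ≤ superhedge (posCone E) G X := by
  rw [superhedge_eq_sInf hm hX]
  refine le_sInf ?_
  rintro _ ⟨m, ⟨g, hg, h⟩, rfl⟩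
  have hXi := integrable_of_mem_dominatedBy hP hXZ hX
  have hXm : Integrable (fun ω => X ω - m) (P : Measure E) := hXi.sub (integrable_const m)
  have h1 : ((∫ ω, (X ω - m) ∂(P : Measure E) : ℝ) : EReal) ≤ penalty G P :=
    (expect_mono_of_integrable hXm fun ω => by linarith [h ω]).trans
      (le_iSup₂ (f := fun X (_ : X ∈ G) => expect P X) g hg)
  rw [expect_of_integrable P hXi]
  refine (EReal.sub_le_sub le_rfl h1).trans ?_
  rw [← EReal.coe_sub, integral_sub hXi (integrable_const m)]
  simp

end Bounded

/-! ### Static positions and the set of gains -/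

variable {J T : ℕ} {Ω : Set (Fin T → Fin (J + 1) → ℝ)} {I : Type*}

/-- Standing assumptions on the derivatives and their costs. -/
structure IsDerivativeMarket (Z : Ω → ℝ) (H : I → Ω → ℝ) (Θ : Set (I →₀ ℝ))
    (h : (I →₀ ℝ) → Ω → ℝ) : Prop where
  payoff_mem : ∀ i, H i ∈ contBoundedBy Z
  zero_mem : 0 ∈ Θ
  cost_mem : ∀ θ ∈ Θ, h θ ∈ contBoundedBy Z
  cost_convex : ConvexOn ℝ Θ h
  cost_zero : h 0 = 0

theorem staticGain_combo {H : I → Ω → ℝ} {Θ : Set (I →₀ ℝ)} {h : (I →₀ ℝ) → Ω → ℝ}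
    (hh : ConvexOn ℝ Θ h) {θ₁ θ₂ : I →₀ ℝ} (h₁ : θ₁ ∈ Θ) (h₂ : θ₂ ∈ Θ) {a b : ℝ} (ha : 0 ≤ a)
    (hb : 0 ≤ b) (hab : a + b = 1) (ω : Ω) :
    a * staticGain H h θ₁ ω + b * staticGain H h θ₂ ω ≤ staticGain H h (a • θ₁ + b • θ₂) ω := by
  have hc := hh.2 h₁ h₂ ha hb hab ω
  simp only [Pi.add_apply, Pi.smul_apply, smul_eq_mul] at hc
  have hs : ((a • θ₁ + b • θ₂).sum fun i c => c * H i ω)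
      = a * (θ₁.sum fun i c => c * H i ω) + b * (θ₂.sum fun i c => c * H i ω) := by
    rw [Finsupp.sum_add_index' (by simp) (by intros; ring), Finsupp.sum_smul_index' (by simp),
      Finsupp.sum_smul_index' (by simp), Finsupp.mul_sum, Finsupp.mul_sum]
    simp only [smul_eq_mul, mul_assoc]
  unfold staticGain
  rw [hs]
  linarith

theorem dynGain_combo (s₀ : Fin J → ℝ) (ϑ₁ ϑ₂ : Fin T → Fin J → Ω → ℝ) (a b : ℝ) (ω : Ω) :
    dynGain s₀ (fun k j ω => a * ϑ₁ k j ω + b * ϑ₂ k j ω) ω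
      = a * dynGain s₀ ϑ₁ ω + b * dynGain s₀ ϑ₂ ω := by
  unfold dynGain
  simp only [Finset.mul_sum, ← Finset.sum_add_distrib]
  refine Finset.sum_congr rfl fun k _ => Finset.sum_congr rfl fun j _ => ?_
  ring

theorem dynGain_zero (s₀ : Fin J → ℝ) : dynGain s₀ (fun _ _ (_ : Ω) => 0) = 0 := by
  ext ω
  simp [dynGain]

theorem isLongStrategy_zero (s₀ : Fin J → ℝ) : IsLongStrategy s₀ (fun _ _ (_ : Ω) => 0) :=
  fun _ _ => ⟨measurable_const, fun _ => le_rfl⟩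

/-- Mixing static positions can only lower the convex cost, so the set of gains is convex only up to
free disposal. -/
theorem gains_convex {s₀ : Fin J → ℝ} {H : I → Ω → ℝ} {Θ : Set (I →₀ ℝ)} {h : (I →₀ ℝ) → Ω → ℝ}
    (hh : ConvexOn ℝ Θ h) {g₁ g₂ : Ω → ℝ} (h₁ : g₁ ∈ gains s₀ H Θ h)
    (h₂ : g₂ ∈ gains s₀ H Θ h) {a b : ℝ} (ha : 0 ≤ a) (hb : 0 ≤ b) (hab : a + b = 1) :
    ∃ g ∈ gains s₀ H Θ h, ∀ ω, a * g₁ ω + b * g₂ ω ≤ g ω := by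
  obtain ⟨ϑ₁, hϑ₁, θ₁, hθ₁, rfl⟩ := h₁
  obtain ⟨ϑ₂, hϑ₂, θ₂, hθ₂, rfl⟩ := h₂
  refine ⟨_, ⟨fun k j ω => a * ϑ₁ k j ω + b * ϑ₂ k j ω, fun k j => ⟨?_, fun ω => ?_⟩,
    a • θ₁ + b • θ₂, hh.1 hθ₁ hθ₂ ha hb hab, rfl⟩, fun ω => ?_⟩
  · exact ((hϑ₁ k j).1.const_mul a).add ((hϑ₂ k j).1.const_mul b)
  · exact add_nonneg (mul_nonneg ha ((hϑ₁ k j).2 ω)) (mul_nonneg hb ((hϑ₂ k j).2 ω))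
  · have := staticGain_combo (H := H) hh hθ₁ hθ₂ ha hb hab ω
    dsimp only
    rw [dynGain_combo]
    linarith

namespace IsDerivativeMarket

variable {Z : Ω → ℝ} {H : I → Ω → ℝ} {Θ : Set (I →₀ ℝ)} {h : (I →₀ ℝ) → Ω → ℝ} {s₀ : Fin J → ℝ}

theorem staticGain_zero (D : IsDerivativeMarket Z H Θ h) : staticGain H h 0 = 0 := by
  ext ω
  simp [staticGain, D.cost_zero]

theorem dynGain_mem (D : IsDerivativeMarket Z H Θ h) {ϑ : Fin T → Fin J → Ω → ℝ}
    (hϑ : IsLongStrategy s₀ ϑ) : dynGain s₀ ϑ ∈ gains s₀ H Θ h :=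
  ⟨ϑ, hϑ, 0, D.zero_mem, by ext ω; simp [D.staticGain_zero]⟩

theorem staticGain_mem {θ : I →₀ ℝ} (hθ : θ ∈ Θ) : staticGain H h θ ∈ gains s₀ H Θ h :=
  ⟨_, isLongStrategy_zero s₀, θ, hθ, by ext ω; simp [dynGain_zero]⟩

theorem zero_mem_gains (D : IsDerivativeMarket Z H Θ h) : (0 : Ω → ℝ) ∈ gains s₀ H Θ h := by
  rw [← dynGain_zero s₀]
  exact D.dynGain_mem (isLongStrategy_zero s₀)

theorem continuous_staticGain (D : IsDerivativeMarket Z H Θ h) {θ : I →₀ ℝ} (hθ : θ ∈ Θ) :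
    Continuous (staticGain H h θ) :=
  (continuous_finsetSum _ fun i _ => continuous_const.mul (D.payoff_mem i).2).sub
    (D.cost_mem θ hθ).2

theorem staticGain_mem_dominatedBy (D : IsDerivativeMarket Z H Θ h) (h1 : ∀ ω, 1 ≤ Z ω)
    {θ : I →₀ ℝ} (hθ : θ ∈ Θ) : staticGain H h θ ∈ dominatedBy Z := by
  have e : staticGain H h θ = ∑ i ∈ θ.support, θ i • H i - h θ := by
    ext ω
    simp [staticGain, Finsupp.sum]
  rw [e]
  exact Submodule.sub_mem _ (Submodule.sum_mem _ fun i _ => Submodule.smul_mem _ _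
    (mem_dominatedBy_of_mem_boundedBy h1 (D.payoff_mem i).1))
    (mem_dominatedBy_of_mem_boundedBy h1 (D.cost_mem θ hθ).1)

theorem measurable_gains (D : IsDerivativeMarket Z H Θ h) {g : Ω → ℝ}
    (hg : g ∈ gains s₀ H Θ h) : Measurable g := by
  obtain ⟨ϑ, hϑ, θ, hθ, rfl⟩ := hg
  exact (measurable_dynGain hϑ).add (D.continuous_staticGain hθ).measurable

theorem penalty_eq (D : IsDerivativeMarket Z H Θ h) (h1 : ∀ ω, 1 ≤ Z ω)
    {P : ProbabilityMeasure Ω} (hP : Integrable Z (P : Measure Ω))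
    (hS : IsSupermartingaleMeasure s₀ P) :
    penalty (gains s₀ H Θ h) P = ⨆ θ ∈ Θ, expect P (staticGain H h θ) := by
  refine le_antisymm (iSup₂_le ?_) (iSup₂_le fun θ hθ => ?_)
  · rintro _ ⟨ϑ, hϑ, θ, hθ, rfl⟩
    have hm := (D.continuous_staticGain hθ).measurable
    exact (hS.expect_le hϑ hm (integrable_of_mem_dominatedBy hP
      (D.staticGain_mem_dominatedBy h1 hθ) hm)).trans
      (le_iSup₂ (f := fun θ (_ : θ ∈ Θ) => expect P (staticGain H h θ)) θ hθ)
  · exact le_iSup₂ (f := fun X (_ : X ∈ gains s₀ H Θ h) => expect P X) _ (staticGain_mem hθ)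

end IsDerivativeMarket

/-! ### Penalty, tail hedges and strong duality in the market -/

section Market

variable {a b : Fin T → ℝ} {s₀ : Fin J → ℝ} {p : ℝ} {H : I → Ω → ℝ} {Θ : Set (I →₀ ℝ)}
  {h : (I →₀ ℝ) → Ω → ℝ}

/-- The penalty is determined by continuous dominated gains. -/
theorem penalty_le_of_forall_continuous (M : IsPriceModel Ω a b s₀) (hp : 1 ≤ p)
    (D : IsDerivativeMarket (growth s₀ p) H Θ h) {P : ProbabilityMeasure Ω}
    (hP : Integrable (growth s₀ p) (P : Measure Ω)) {c : ℝ}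
    (hc : ∀ g ∈ gains s₀ H Θ h, Continuous g → g ∈ dominatedBy (growth s₀ p) →
      ∫ ω, g ω ∂(P : Measure Ω) ≤ c) :
    penalty (gains s₀ H Θ h) P ≤ (c : EReal) := by
  have h1 := M.one_le_growth p
  have hS : IsSupermartingaleMeasure s₀ P := M.isSupermartingaleMeasure hp hP
    fun ϑ hϑ hcont hdom => hc _ (D.dynGain_mem hϑ) hcont hdom
  rw [D.penalty_eq h1 hP hS]
  refine iSup₂_le fun θ hθ => ?_
  have hcont := D.continuous_staticGain hθ
  have hdom := D.staticGain_mem_dominatedBy h1 hθ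
  rw [expect_of_integrable P (integrable_of_mem_dominatedBy hP hdom hcont.measurable)]
  exact EReal.coe_le_coe_iff.2 (hc _ (IsDerivativeMarket.staticGain_mem hθ) hcont hdom)

/-- A penalty other than +∞ would be a real bound on continuous dominated long gains, which forces
the supermartingale property. -/
theorem penalty_eq_top (M : IsPriceModel Ω a b s₀) (hp : 1 ≤ p)
    (D : IsDerivativeMarket (growth s₀ p) H Θ h) {P : ProbabilityMeasure Ω}
    (hP : Integrable (growth s₀ p) (P : Measure Ω)) (hS : ¬ IsSupermartingaleMeasure s₀ P) :
    penalty (gains s₀ H Θ h) P = ⊤ := by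
  by_contra htop
  refine hS (M.isSupermartingaleMeasure hp hP (C := (penalty (gains s₀ H Θ h) P).toReal) ?_)
  intro ϑ hϑ hcont hdom
  have hle : expect P (dynGain s₀ ϑ) ≤ penalty (gains s₀ H Θ h) P :=
    le_iSup₂ (f := fun X (_ : X ∈ gains s₀ H Θ h) => expect P X) _ (D.dynGain_mem hϑ)
  rw [expect_of_integrable P (integrable_of_mem_dominatedBy hP hdom hcont.measurable)] at hle
  have hbot : penalty (gains s₀ H Θ h) P ≠ ⊥ := fun hb =>
    absurd (hb ▸ hle) (not_le.2 (EReal.bot_lt_coe _))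
  rw [← EReal.coe_toReal htop hbot] at hle
  exact EReal.coe_le_coe_iff.1 hle

/-- Averaging the call hedges over all dates and assets superhedges a multiple of the sum of the
calls at cost at most 1; for large growth that sum is at least half of it. -/
theorem CallCondition.tail (M : IsPriceModel Ω a b s₀)
    (D : IsDerivativeMarket (growth s₀ p) H Θ h)
    (hcall : CallCondition s₀ p (gains s₀ H Θ h)) (c : ℝ) :
    ∃ R : ℝ, ∃ g ∈ gains s₀ H Θ h, ∀ ω, -1 ≤ g ω ∧
      (R < growth s₀ p ω → c * growth s₀ p ω ≤ 1 + g ω) := by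
  have hgrowth : ∀ ω : Ω, growth s₀ p ω
      = 1 + ∑ i : Fin T × Fin J, discPrice s₀ i.1.succ i.2 ω ^ p := fun ω => by
    rw [growth, Fintype.sum_prod_type]
  -- Without dates or risky assets the growth is constantly 1, so R = 1 makes the tail requirement
  -- vacuous.
  rcases isEmpty_or_nonempty (Fin T × Fin J) with he | hne
  · refine ⟨1, 0, D.zero_mem_gains, fun ω => ⟨by simp, fun hlt => ?_⟩⟩
    rw [hgrowth] at hlt
    simp at hlt
  obtain ⟨N, hN⟩ : ∃ N : ℝ, ((Fintype.card (Fin T × Fin J) : ℕ) : ℝ) = N := ⟨_, rfl⟩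
  have hN0 : 0 < N := hN ▸ Nat.cast_pos.2 Fintype.card_pos
  obtain ⟨n₀, hn₀⟩ := exists_nat_ge (2 * |c| * N)
  set n : ℕ := n₀ + 1 with hn
  have hn1 : (1 : ℝ) ≤ n := by simp [hn]
  have hcn : 2 * |c| * N ≤ n := hn₀.trans (by simp [hn])
  choose X hX K hK hXK using fun i : Fin T × Fin J => hcall n (by simp [hn]) i.2 i.1
  have hconv : Convex ℝ {f : Ω → ℝ | ∃ g ∈ gains s₀ H Θ h, ∀ ω, f ω ≤ g ω} := by
    rintro f₁ ⟨g₁, hg₁, hf₁⟩ f₂ ⟨g₂, hg₂, hf₂⟩ u v hu hv huv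
    obtain ⟨g, hg, hle⟩ := gains_convex D.cost_convex hg₁ hg₂ hu hv huv
    refine ⟨g, hg, fun ω => le_trans ?_ (hle ω)⟩
    exact add_le_add (mul_le_mul_of_nonneg_left (hf₁ ω) hu) (mul_le_mul_of_nonneg_left (hf₂ ω) hv)
  obtain ⟨g, hg, hle⟩ := hconv.sum_mem (t := Finset.univ) (w := fun _ : Fin T × Fin J => N⁻¹)
    (z := X) (fun _ _ => inv_nonneg.2 hN0.le)
    (by rw [Finset.sum_const, Finset.card_univ, nsmul_eq_mul, hN]; exact mul_inv_cancel₀ hN0.ne')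
    (fun i _ => ⟨X i, hX i, fun _ => le_rfl⟩)
  have hlow : ∀ ω, N⁻¹ * ∑ i : Fin T × Fin J,
      (n * max (discPrice s₀ i.1.succ i.2 ω ^ p - K i) 0 - 1) ≤ g ω := fun ω => by
    refine le_trans ?_ (hle ω)
    rw [Finset.sum_apply, Finset.mul_sum]
    refine Finset.sum_le_sum fun i _ => mul_le_mul_of_nonneg_left ?_ (inv_nonneg.2 hN0.le)
    refine le_trans (sub_le_sub_left ?_ _) (hXK i ω)
    exact (div_le_one (zero_lt_one.trans_le hn1)).2 hn1
  have hsum : ∀ ω, N⁻¹ * n * ∑ i : Fin T × Fin J,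
      max (discPrice s₀ i.1.succ i.2 ω ^ p - K i) 0 ≤ 1 + g ω := fun ω => by
    have := hlow ω
    rw [Finset.sum_sub_distrib, ← Finset.mul_sum, Finset.sum_const, Finset.card_univ,
      nsmul_eq_mul, hN, mul_one, mul_sub, inv_mul_cancel₀ hN0.ne', ← mul_assoc] at this
    linarith
  -- The sum S of calls satisfies S ≥ Z − 1 − ∑ K, which exceeds Z/2 beyond this R. Then c Z ≤ 2|c|
  -- S ≤ (n/N) S because n ≥ 2|c|N.
  refine ⟨2 * (1 + ∑ i, K i), g, hg, fun ω => ⟨?_, fun hR => ?_⟩⟩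
  · have : 0 ≤ N⁻¹ * n * ∑ i : Fin T × Fin J,
        max (discPrice s₀ i.1.succ i.2 ω ^ p - K i) 0 :=
      mul_nonneg (by positivity) (Finset.sum_nonneg fun _ _ => le_max_right _ _)
    linarith [hsum ω]
  · refine le_trans ?_ (hsum ω)
    set S : ℝ := ∑ i : Fin T × Fin J, max (discPrice s₀ i.1.succ i.2 ω ^ p - K i) 0 with hS
    have h1 : growth s₀ p ω - 1 - ∑ i, K i ≤ S := by
      have : ∑ i : Fin T × Fin J, (discPrice s₀ i.1.succ i.2 ω ^ p - K i) ≤ S :=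
        Finset.sum_le_sum fun _ _ => le_max_left _ _
      rw [Finset.sum_sub_distrib] at this
      linarith [hgrowth ω]
    have h2 : growth s₀ p ω ≤ 2 * S := by linarith
    have hZ0 : 0 ≤ growth s₀ p ω := zero_le_one.trans (M.one_le_growth p ω)
    have hS0 : 0 ≤ S := by linarith
    calc c * growth s₀ p ω ≤ |c| * (2 * S) :=
          mul_le_mul (le_abs_self c) h2 hZ0 (abs_nonneg c)
      _ = N⁻¹ * (2 * |c| * N) * S := by field_simp
      _ ≤ N⁻¹ * n * S := by gcongr

theorem isHedgingSet_gains (M : IsPriceModel Ω a b s₀)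
    (D : IsDerivativeMarket (growth s₀ p) H Θ h)
    (hcall : CallCondition s₀ p (gains s₀ H Θ h))
    (hNA : ¬ ∃ X ∈ gains s₀ H Θ h, ∃ ε : ℝ, 0 < ε ∧ ∀ ω, ε ≤ X ω) :
    IsHedgingSet (growth s₀ p) (gains s₀ H Θ h) where
  one_le := M.one_le_growth p
  zero_mem := D.zero_mem_gains
  convex := fun _ h₁ _ h₂ _ _ ha hb hab => gains_convex D.cost_convex h₁ h₂ ha hb hab
  noArbitrage := fun g hg ε hε => by
    by_contra hcon
    exact hNA ⟨g, hg, ε, hε, fun ω => not_lt.1 fun hlt => hcon ⟨ω, hlt⟩⟩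
  tail := hcall.tail M D

/-- Superhedging duality with attainment. -/
theorem isGreatest_superhedge (M : IsPriceModel Ω a b s₀) (hp : 1 ≤ p)
    (D : IsDerivativeMarket (growth s₀ p) H Θ h)
    (hG : IsHedgingSet (growth s₀ p) (gains s₀ H Θ h)) {X : Ω → ℝ}
    (hX : X ∈ uscBoundedBy (growth s₀ p)) :
    IsGreatest ((fun P => expect P X - penalty (gains s₀ H Θ h) P) '' probInt (growth s₀ p))
      (superhedge (posCone Ω) (gains s₀ H Θ h) X) := by
  have hm : ∀ g ∈ gains s₀ H Θ h, Measurable g := fun g hg => D.measurable_gains hg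
  have hXZ := mem_dominatedBy_of_mem_boundedBy (M.one_le_growth p) hX.1
  have hub : ∀ P ∈ probInt (growth s₀ p), expect P X - penalty (gains s₀ H Θ h) P
      ≤ superhedge (posCone Ω) (gains s₀ H Θ h) X :=
    fun P hP => expect_sub_penalty_le hm hP hX.1.1 hXZ
  have := M.locallyCompactSpace
  obtain ⟨P, hP, hdual⟩ := hG.exists_dual (M.continuous_growth hp)
    (M.isCompact_growth_le hp) hXZ hX.2
  refine ⟨⟨P, hP, le_antisymm (hub P hP) ?_⟩, ?_⟩
  · have hpen := penalty_le_of_forall_continuous M hp D hP hdual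
    rw [hG.superhedge_eq hm hX.1.1 hXZ]
    dsimp only
    rw [expect_of_integrable P (integrable_of_mem_dominatedBy hP hXZ hX.1.1)]
    -- The penalty is at most E X − φ(X), so E X minus the penalty is at least φ(X).
    refine le_trans ?_ (EReal.sub_le_sub le_rfl hpen)
    rw [← EReal.coe_sub, sub_sub_cancel]
  · rintro _ ⟨P, hP, rfl⟩
    exact hub P hP

theorem zero_mem_uscBoundedBy {E : Type*} [MeasurableSpace E] [TopologicalSpace E] (Z : E → ℝ) :
    (0 : E → ℝ) ∈ uscBoundedBy Z :=
  ⟨⟨measurable_const, 0, fun ω => by simp⟩, continuous_const.upperSemicontinuous⟩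

end Market

end ShortSelling

end

open ShortSelling in
theorem proposition3p2 {J T : ℕ} (Ω : Set (Fin T → Fin (J + 1) → ℝ))
    (hne : Ω.Nonempty) (hclosed : IsClosed Ω)
    (a b : Fin T → ℝ) (ha : ∀ k, 0 < a k) (hab : ∀ k, a k ≤ b k)
    (hΩ : ∀ ω ∈ Ω, ∀ k, ω k 0 ∈ Set.Icc (a k) (b k) ∧ ∀ j : Fin J, 0 ≤ ω k j.succ)
    (s₀ : Fin J → ℝ) (hs₀ : ∀ j, 0 ≤ s₀ j)
    (p : ℝ) (hp : 1 ≤ p) (Z : Ω → ℝ) (hZ : Z = growth s₀ p)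
    {I : Type*} (H : I → Ω → ℝ) (hH : ∀ i, H i ∈ contBoundedBy Z)
    (Θ : Set (I →₀ ℝ)) (hΘ : Convex ℝ Θ) (hΘ0 : 0 ∈ Θ)
    (h : (I →₀ ℝ) → Ω → ℝ) (hhC : ∀ θ ∈ Θ, h θ ∈ contBoundedBy Z)
    (hhconv : ConvexOn ℝ Θ h) (hh0 : h 0 = 0)
    (G : Set (Ω → ℝ)) (hG : G = gains s₀ H Θ h) :
    (∀ P ∈ probInt Z,
      (IsSupermartingaleMeasure s₀ P → penalty G P = ⨆ θ ∈ Θ, expect P (staticGain H h θ)) ∧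
      (¬ IsSupermartingaleMeasure s₀ P → penalty G P = ⊤)) ∧
    (CallCondition s₀ p G →
      List.TFAE [
        ¬ ∃ X ∈ G, ∃ ε : ℝ, 0 < ε ∧ ∀ ω, ε ≤ X ω,
        ¬ ∃ X ∈ G, ∀ ω, 0 < X ω,
        (genMartMeasures Z G).Nonempty,
        (∀ X ∈ boundedBy Z, ∃ r : ℝ, superhedge (posCone Ω) G X = (r : EReal)) ∧
          superhedge (posCone Ω) G 0 = 0 ∧
          ∀ X ∈ uscBoundedBy Z,
            IsGreatest ((fun P => expect P X - penalty G P) '' probInt Z)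
              (superhedge (posCone Ω) G X)]) := by
  subst hZ hG
  have M : IsPriceModel Ω a b s₀ := ⟨hclosed, ha, hΩ, hs₀⟩
  have D : IsDerivativeMarket (growth s₀ p) H Θ h := ⟨hH, hΘ0, hhC, hhconv, hh0⟩
  refine ⟨fun P hP => ⟨D.penalty_eq (M.one_le_growth p) hP, penalty_eq_top M hp D hP⟩,
    fun hcall => ?_⟩
  have hm : ∀ g ∈ gains s₀ H Θ h, Measurable g := fun g hg => D.measurable_gains hg
  tfae_have 1 → 4 := fun hNA => by
    have hG := isHedgingSet_gains M D hcall hNA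
    refine ⟨fun X hX => ⟨_, hG.superhedge_eq hm hX.1
      (mem_dominatedBy_of_mem_boundedBy hG.one_le hX)⟩, ?_,
      fun X hX => isGreatest_superhedge M hp D hG hX⟩
    rw [hG.superhedge_eq hm (X := 0) measurable_const (Submodule.zero_mem _), hG.cost_zero,
      EReal.coe_zero]
  tfae_have 4 → 3 := fun ⟨_, h0, hmax⟩ => by
    obtain ⟨P, hP, hPeq⟩ := (hmax 0 (zero_mem_uscBoundedBy _)).1
    refine ⟨P, hP, ?_⟩
    have he : expect P (0 : Ω → ℝ) = 0 := by
      rw [expect_of_integrable P (MeasureTheory.integrable_zero _ _ _)]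
      simp
    dsimp only at hPeq
    rw [h0, he, zero_sub, EReal.neg_eq_zero_iff] at hPeq
    exact hPeq
  tfae_have 3 → 2 := fun ⟨P, _, hP⟩ ⟨X, hX, hpos⟩ => by
    have h1 : expect P X ≤ penalty (gains s₀ H Θ h) P :=
      le_iSup₂ (f := fun X (_ : X ∈ gains s₀ H Θ h) => expect P X) X hX
    rw [hP] at h1
    exact absurd (expect_pos (hm X hX) hpos) (not_lt.2 h1)
  tfae_have 2 → 1 := fun h2 ⟨X, hX, ε, hε, hle⟩ => h2 ⟨X, hX, fun ω => hε.trans_le (hle ω)⟩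
  tfae_finish
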